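/- Definitions. A \emph{residuated De Morgan lattice} is an algebra $\mathbf A=\langle A,\wedge,\vee,\supset,\neg,\top\rangle$ such that $\langle A,\wedge,\vee,\neg\rangle$ is a De Morgan lattice (a distributive lattice with $\neg\neg x=x$ and the De Morgan laws for $\neg$) and the following equations hold: (RD0) $\top\approx\neg\top$; (RD1) $\top\supset x\approx x$; (RD2) $x\supset(y\supset z)\approx(x\wedge y)\supset z$; (RD3) $\top\wedge(((x\supset y)\supset x)\supset x)\approx\top$; (RD4) $(x\vee y)\supset z\approx(x\supset z)\wedge(y\supset z)$; (RD5) $x\wedge(((x\supset y)\wedge(\neg y\supset\neg x))\supset y)\approx x$; (RD6) $\neg(x\supset y)\supset z\approx(x\wedge\neg y)\supset z$. An \emph{implicative bilattice} is an algebra $\mathbf B=\langle B,\wedge,\vee,\otimes,\oplus,\supset,\neg\rangle$ such that $\langle B,\wedge,\vee\rangle$ is a lattice with order $\le_t$, $\langle B,\otimes,\oplus\rangle$ is a lattice with order $\le_k$, $\neg$ is an involution that reverses $\le_t$ and preserves $\le_k$, and the following equations hold: (IB1) $(x\supset x)\supset y\approx y$; (IB2) $x\supset(y\supset z)\approx(x\wedge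 y)\supset z\approx(x\otimes y)\supset z$; (IB3) $((x\supset y)\supset x)\supset x\approx x\supset x$; (IB4) $(x\vee y)\supset z\approx(x\supset z)\wedge(y\supset z)\approx(x\oplus y)\supset z$; (IB5) $x\wedge((x\supset y)\supset(x\otimes y))\approx x$; (IB6) $\neg(x\supset y)\supset z\approx(x\wedge\neg y)\supset z$. In $\mathbf B$ the constant $\top$ denotes $(x\supset x)\oplus\neg(x\supset x)$, which does not depend on $x$. If $\mathbf L$ is a distributive lattice with greatest element $1$ in which every $a$ has a (necessarily unique) complement $a\backslash b$ in the interval $[a\sqcap b,1]$ for all $b$, then $\langle\mathbf L\odot\mathbf L,\supset\rangle$ is the algebra on $L\times L$ with $\langle a_1,a_2\rangle\wedge\langle b_1,b_2\rangle=\langle a_1\sqcap b_1,a_2\sqcup b_2\rangle$, $\langle a_1,a_2\rangle\vee\langle b_1,b_2\rangle=\langle a_1\sqcup b_1,a_2\sqcap b_2\rangle$, $\langle a_1,a_2\rangle\otimes\langle b_1,b_2\rangle=\langle a_1\sqcap b_1,a_2\sqcap b_2\rangle$, $\langle a_1,a_2\rangle\oplus\langle b_1,b_2\rangle=\langle a_1\sqcup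 b_1,a_2\sqcup b_2\rangle$, $\neg\langle a_1,a_2\rangle=\langle a_2,a_1\rangle$, $\langle a_1,a_2\rangle\supset\langle b_1,b_2\rangle=\langle a_1\backslash b_1,a_1\sqcap b_2\rangle$. Theorem. (1) Let $\mathbf A$ be a residuated De Morgan lattice, and let $\mathbf A^-$ and $\mathbf A^+$ be the sublattices of $\langle A,\wedge,\vee\rangle$ with universes $A^-=\{a: a\le\top\}$ and $A^+=\{a: a\ge\top\}$. Then: (i) $\mathbf A^-$ is dually isomorphic to $\mathbf A^+$. (ii) In $\mathbf A^-$ and in $\mathbf A^+$ every element of every interval $[a,c]$ has a complement in $[a,c]$. (iii) In $\mathbf A^-$ the complement of $a$ in $[a\wedge b,\top]$ is $a\backslash b=(a\supset(a\wedge b))\wedge\top$, the algebra $\mathbf B=\langle\mathbf A^-\odot\mathbf A^-,\supset\rangle$ is an implicative bilattice, and $h(a)=\langle a\wedge\top,\neg a\wedge\top\rangle$ is an injective $\{\wedge,\vee,\supset,\neg,\top\}$-homomorphism of $\mathbf A$ into $\mathbf B$. The same holds with $\mathbf A^+$, taken with the dual order, in place of $\mathbf A^-$, with $a\backslash b=\neg(\neg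 a\supset\neg(a\vee b))\vee\top$ and the map $a\mapsto\langle\neg a\vee\top,a\vee\top\rangle$. (iv) If $f$ is a $\{\wedge,\vee,\supset,\neg,\top\}$-homomorphism of $\mathbf A$ into an implicative bilattice $\mathbf B_1$, then there is a unique homomorphism of implicative bilattices $f':\mathbf B\to\mathbf B_1$ with $f'\circ h=f$. If $f$ is injective, so is $f'$. (2) An algebra $\langle A,\wedge,\vee,\supset,\neg,\top\rangle$ is a residuated De Morgan lattice if and only if there is an injective $\{\wedge,\vee,\supset,\neg,\top\}$-homomorphism of it into some implicative bilattice. (3) Up to isomorphism there is exactly one residuated De Morgan lattice with four elements. Its elements are $\mathsf f,\bot,\top,\mathsf t$, where $\mathsf f$ is least, $\mathsf t$ is greatest, $\bot$ and $\top$ are incomparable, $\neg$ exchanges $\mathsf f$ and $\mathsf t$ and fixes $\bot$ and $\top$, and $a\supset b=b$ if $a\in\{\top,\mathsf t\}$, $a\supset b=\mathsf t$ otherwise. (4) The variety of residuated De Morgan lattices is generated by this four-element algebra $\mathbf M$: an algebra $\langle A,\wedge,\vee,\supset,\neg,\top\rangle$ is a residuated De Morgan lattice if and only if it satisfies every equation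 valid in $\mathbf M$, and if and only if it is a homomorphic image of a subalgebra of a power of $\mathbf M$. -/

import Mathlib

universe u v w

/-! ## Algebras in the two signatures -/

/-- Algebras of type `⟨A, ∧, ∨, ⊃, ¬, ⊤⟩`, written `⊓, ⊔, ⇨, ￢, ⊤`. No law is assumed here. -/
class RDMSig (A : Type u) extends Min A, Max A, HImp A, HNot A, Top A

/-- Algebras of type `⟨B, ∧, ∨, ⊗, ⊕, ⊃, ¬⟩`, written `⊓, ⊔, ⊗ₖ, ⊕ₖ, ⇨, ￢`.
No law is assumed here. -/
class BilatSig (B : Type u) extends Min B, Max B, HImp B, HNot B where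
  ktimes : B → B → B
  kplus : B → B → B

infixl:69 " ⊗ₖ " => BilatSig.ktimes
infixl:68 " ⊕ₖ " => BilatSig.kplus

/-- The lattice identities for a pair of binary operations (meet, join). -/
structure IsLatticePair {α : Type u} (m j : α → α → α) : Prop where
  meet_comm : ∀ x y, m x y = m y x
  join_comm : ∀ x y, j x y = j y x
  meet_assoc : ∀ x y z, m (m x y) z = m x (m y z)
  join_assoc : ∀ x y z, j (j x y) z = j x (j y z)
  meet_join : ∀ x y, m x (j x y) = x
  join_meet : ∀ x y, j x (m x y) = x

/-- Residuated De Morgan lattices. -/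
class IsRDML (A : Type u) [RDMSig A] : Prop where
  lattice : IsLatticePair (fun x y : A => x ⊓ y) (fun x y : A => x ⊔ y)
  distrib : ∀ x y z : A, x ⊓ (y ⊔ z) = (x ⊓ y) ⊔ (x ⊓ z)
  neg_neg : ∀ x : A, ￢(￢x) = x
  neg_inf : ∀ x y : A, ￢(x ⊓ y) = (￢x) ⊔ (￢y)
  neg_sup : ∀ x y : A, ￢(x ⊔ y) = (￢x) ⊓ (￢y)
  rd0 : (⊤ : A) = ￢(⊤ : A)
  rd1 : ∀ x : A, (⊤ ⇨ x) = x
  rd2 : ∀ x y z : A, (x ⇨ (y ⇨ z)) = ((x ⊓ y) ⇨ z)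
  rd3 : ∀ x y : A, ⊤ ⊓ (((x ⇨ y) ⇨ x) ⇨ x) = ⊤
  rd4 : ∀ x y z : A, ((x ⊔ y) ⇨ z) = (x ⇨ z) ⊓ (y ⇨ z)
  rd5 : ∀ x y : A, x ⊓ (((x ⇨ y) ⊓ ((￢y) ⇨ (￢x))) ⇨ y) = x
  rd6 : ∀ x y z : A, ((￢(x ⇨ y)) ⇨ z) = ((x ⊓ ￢y) ⇨ z)

/-- Implicative bilattices. The truth order is `x ≤ₜ y ↔ x ⊓ y = x`, the knowledge order is
`x ≤ₖ y ↔ x ⊗ₖ y = x`. -/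
class IsImplicativeBilattice (B : Type u) [BilatSig B] : Prop where
  tlattice : IsLatticePair (fun x y : B => x ⊓ y) (fun x y : B => x ⊔ y)
  klattice : IsLatticePair (fun x y : B => x ⊗ₖ y) (fun x y : B => x ⊕ₖ y)
  neg1 : ∀ x y : B, x ⊓ y = x → (￢y) ⊓ (￢x) = ￢y
  neg2 : ∀ x y : B, x ⊗ₖ y = x → (￢x) ⊗ₖ (￢y) = ￢x
  neg3 : ∀ x : B, x = ￢(￢x)
  ib1 : ∀ x y : B, ((x ⇨ x) ⇨ y) = y
  ib2 : ∀ x y z : B, (x ⇨ (y ⇨ z)) = ((x ⊓ y) ⇨ z)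
  ib2' : ∀ x y z : B, ((x ⊓ y) ⇨ z) = ((x ⊗ₖ y) ⇨ z)
  ib3 : ∀ x y : B, (((x ⇨ y) ⇨ x) ⇨ x) = (x ⇨ x)
  ib4 : ∀ x y z : B, ((x ⊔ y) ⇨ z) = (x ⇨ z) ⊓ (y ⇨ z)
  ib4' : ∀ x y z : B, (x ⇨ z) ⊓ (y ⇨ z) = ((x ⊕ₖ y) ⇨ z)
  ib5 : ∀ x y : B, x ⊓ ((x ⇨ y) ⇨ (x ⊗ₖ y)) = x
  ib6 : ∀ x y z : B, ((￢(x ⇨ y)) ⇨ z) = ((x ⊓ ￢y) ⇨ z)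

/-- The term `(x ⊃ x) ⊕ ¬(x ⊃ x)`, which is the constant `⊤` of an implicative bilattice. -/
def kTop {B : Type u} [BilatSig B] (x : B) : B := (x ⇨ x) ⊕ₖ ￢(x ⇨ x)

/-! ## Homomorphisms -/

/-- Homomorphisms of `{∧, ∨, ⊃, ¬, ⊤}`-algebras. -/
structure IsRDMHom {A : Type u} {C : Type v} [RDMSig A] [RDMSig C] (f : A → C) : Prop where
  map_inf : ∀ x y, f (x ⊓ y) = f x ⊓ f y
  map_sup : ∀ x y, f (x ⊔ y) = f x ⊔ f y
  map_imp : ∀ x y, f (x ⇨ y) = (f x ⇨ f y)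
  map_neg : ∀ x, f (￢x) = ￢(f x)
  map_top : f ⊤ = ⊤

/-- Homomorphisms of full bilattice-with-implication algebras. -/
structure IsBilatHom {B : Type u} {C : Type v} [BilatSig B] [BilatSig C] (f : B → C) : Prop where
  map_inf : ∀ x y, f (x ⊓ y) = f x ⊓ f y
  map_sup : ∀ x y, f (x ⊔ y) = f x ⊔ f y
  map_ktimes : ∀ x y, f (x ⊗ₖ y) = f x ⊗ₖ f y
  map_kplus : ∀ x y, f (x ⊕ₖ y) = f x ⊕ₖ f y
  map_imp : ∀ x y, f (x ⇨ y) = (f x ⇨ f y)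
  map_neg : ∀ x, f (￢x) = ￢(f x)

/-- Homomorphisms from a `{∧, ∨, ⊃, ¬, ⊤}`-algebra to the corresponding reduct of a bilattice with
implication; the constant `⊤` of the target is the value of the term `kTop`. -/
structure IsReductHom {A : Type u} {B : Type v} [RDMSig A] [BilatSig B] (f : A → B) : Prop where
  map_inf : ∀ x y, f (x ⊓ y) = f x ⊓ f y
  map_sup : ∀ x y, f (x ⊔ y) = f x ⊔ f y
  map_imp : ∀ x y, f (x ⇨ y) = (f x ⇨ f y)
  map_neg : ∀ x, f (￢x) = ￢(f x)
  map_top : ∀ b : B, f ⊤ = kTop b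

/-! ## The product bilattice `L ⊙ L` with its implication -/

/-- The carrier `L × L` of the product bilattice. -/
@[ext]
structure ProdBilat (L : Type u) where
  fst : L
  snd : L

/-- The operations of `⟨L ⊙ L, ⊃⟩`, where `⇨` on `L` is the relative complement operation `\`. -/
instance {L : Type u} [Min L] [Max L] [HImp L] : BilatSig (ProdBilat L) where
  min a b := ⟨a.fst ⊓ b.fst, a.snd ⊔ b.snd⟩
  max a b := ⟨a.fst ⊔ b.fst, a.snd ⊓ b.snd⟩
  ktimes a b := ⟨a.fst ⊓ b.fst, a.snd ⊓ b.snd⟩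
  kplus a b := ⟨a.fst ⊔ b.fst, a.snd ⊔ b.snd⟩
  himp a b := ⟨a.fst ⇨ b.fst, a.fst ⊓ b.snd⟩
  hnot a := ⟨a.snd, a.fst⟩

/-- Every element has a complement in every interval: if `a ≤ b ≤ c`, then `b` has a complement
in `[a, c]`. -/
def IsRelativelyComplemented (L : Type u) [Min L] [Max L] : Prop :=
  ∀ a b c : L, a ⊓ b = a → b ⊓ c = b → ∃ d, b ⊓ d = a ∧ b ⊔ d = c

/-- The operation `⇨` of a lattice with greatest element `⊤` assigns to `a, b` the one and only
complement of `a` in the interval `[a ⊓ b, ⊤]`. -/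
def HImpIsRelCompl (L : Type u) [Min L] [Max L] [Top L] [HImp L] : Prop :=
  ∀ a b c : L, (a ⊓ c = a ⊓ b ∧ a ⊔ c = ⊤) ↔ c = (a ⇨ b)

/-! ## The sublattices `A⁻` and `A⁺` -/

section Cones

/-- `A⁻ = {a : a ≤ ⊤}`. -/
def NegCone (A : Type u) [RDMSig A] : Type u := {a : A // a ⊓ ⊤ = a}

/-- `A⁺ = {a : ⊤ ≤ a}`. -/
def PosCone (A : Type u) [RDMSig A] : Type u := {a : A // ⊤ ⊓ a = ⊤}

variable {A : Type u} [RDMSig A] [IsRDML A]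

theorem IsRDML.inf_idem (x : A) : x ⊓ x = x := by
  have h := (IsRDML.lattice (A := A)).meet_join x (x ⊓ x)
  have h' := (IsRDML.lattice (A := A)).join_meet x x
  rwa [h'] at h

theorem IsRDML.sup_idem (x : A) : x ⊔ x = x := by
  have h := (IsRDML.lattice (A := A)).join_meet x x
  rwa [IsRDML.inf_idem] at h

theorem IsRDML.inf_top_mem (x : A) : (x ⊓ ⊤) ⊓ ⊤ = x ⊓ ⊤ := by
  have h := (IsRDML.lattice (A := A)).meet_assoc x ⊤ ⊤
  rw [h, IsRDML.inf_idem]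

theorem IsRDML.sup_top_mem (x : A) : ⊤ ⊓ (x ⊔ ⊤) = (⊤ : A) := by
  have h := (IsRDML.lattice (A := A)).join_comm x ⊤
  rw [h]
  exact (IsRDML.lattice (A := A)).meet_join ⊤ x

theorem IsRDML.inf_neg {a b : A} (hb : b ⊓ ⊤ = b) : (a ⊓ b) ⊓ ⊤ = a ⊓ b := by
  have h := (IsRDML.lattice (A := A)).meet_assoc a b ⊤
  rw [h, hb]

theorem IsRDML.sup_neg {a b : A} (ha : a ⊓ ⊤ = a) (hb : b ⊓ ⊤ = b) :
    (a ⊔ b) ⊓ ⊤ = a ⊔ b := by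
  have c := (IsRDML.lattice (A := A)).meet_comm
  rw [c, IsRDML.distrib, c ⊤ a, c ⊤ b, ha, hb]

theorem IsRDML.inf_pos {a b : A} (ha : ⊤ ⊓ a = ⊤) (hb : ⊤ ⊓ b = ⊤) : ⊤ ⊓ (a ⊓ b) = (⊤ : A) := by
  have h := (IsRDML.lattice (A := A)).meet_assoc ⊤ a b
  rw [← h, ha, hb]

theorem IsRDML.sup_pos {a b : A} (ha : ⊤ ⊓ a = ⊤) (hb : ⊤ ⊓ b = ⊤) : ⊤ ⊓ (a ⊔ b) = (⊤ : A) := by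
  rw [IsRDML.distrib, ha, hb, IsRDML.sup_idem]

instance : Min (NegCone A) := ⟨fun a b => ⟨a.1 ⊓ b.1, IsRDML.inf_neg b.2⟩⟩
instance : Max (NegCone A) := ⟨fun a b => ⟨a.1 ⊔ b.1, IsRDML.sup_neg a.2 b.2⟩⟩
instance : Top (NegCone A) := ⟨⟨⊤, IsRDML.inf_idem ⊤⟩⟩

/-- The operation `\` of `A⁻`, namely `a \ b = (a ⊃ (a ∧ b)) ∧ ⊤`. -/
instance : HImp (NegCone A) := ⟨fun a b => ⟨(a.1 ⇨ (a.1 ⊓ b.1)) ⊓ ⊤, IsRDML.inf_top_mem _⟩⟩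

instance : Min (PosCone A) := ⟨fun a b => ⟨a.1 ⊓ b.1, IsRDML.inf_pos a.2 b.2⟩⟩
instance : Max (PosCone A) := ⟨fun a b => ⟨a.1 ⊔ b.1, IsRDML.sup_pos a.2 b.2⟩⟩
instance : Bot (PosCone A) := ⟨⟨⊤, IsRDML.inf_idem ⊤⟩⟩

/-- The operation `\` of `A⁺` with the dual order, in which `⊤` is the greatest element. It is the
operation of `A⁻` carried over by the negation. -/
instance : HImp (PosCone A)ᵒᵈ :=
  ⟨fun a b => OrderDual.toDual
    ⟨(￢((￢(OrderDual.ofDual a).1) ⇨ ￢((OrderDual.ofDual a).1 ⊔ (OrderDual.ofDual b).1))) ⊔ ⊤,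
      IsRDML.sup_top_mem _⟩⟩

/-- The canonical map `A → A⁻ ⊙ A⁻`. -/
def negEmb (a : A) : ProdBilat (NegCone A) :=
  ⟨⟨a ⊓ ⊤, IsRDML.inf_top_mem a⟩, ⟨(￢a) ⊓ ⊤, IsRDML.inf_top_mem _⟩⟩

/-- The corresponding map for `A⁺`, taken with the dual order. -/
def posEmb (a : A) : ProdBilat (PosCone A)ᵒᵈ :=
  ⟨OrderDual.toDual ⟨(￢a) ⊔ ⊤, IsRDML.sup_top_mem _⟩,
    OrderDual.toDual ⟨a ⊔ ⊤, IsRDML.sup_top_mem a⟩⟩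

end Cones

/-! ## The four-element algebra -/

/-- The elements of `FOUR`. -/
inductive Four : Type
  | f | bot | top | t
  deriving DecidableEq

/-- The `{∧, ∨, ⊃, ¬, ⊤}`-reduct of `FOUR` with implication. In the truth order `f` is least,
`t` is greatest, and `bot`, `top` are incomparable; `¬` exchanges `f` and `t` and fixes `bot` and
`top`; `a ⊃ b` is `b` if `a ∈ {top, t}` and `t` otherwise. -/
instance : RDMSig Four where
  min
    | .f, _ => .f
    | .t, y => y
    | .bot, .bot => .bot
    | .bot, .t => .bot
    | .bot, _ => .f
    | .top, .top => .top
    | .top, .t => .top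
    | .top, _ => .f
  max
    | .t, _ => .t
    | .f, y => y
    | .bot, .bot => .bot
    | .bot, .f => .bot
    | .bot, _ => .t
    | .top, .top => .top
    | .top, .f => .top
    | .top, _ => .t
  himp
    | .top, y => y
    | .t, y => y
    | _, _ => .t
  hnot
    | .f => .t
    | .t => .f
    | .bot => .bot
    | .top => .top
  top := .top

/-! ## Equations and generated varieties -/

/-- Terms in the variables `x₀, x₁, …` and the operation symbols `∧, ∨, ⊃, ¬, ⊤`. -/
inductive RDMTerm : Type
  | var : ℕ → RDMTerm
  | inf : RDMTerm → RDMTerm → RDMTerm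
  | sup : RDMTerm → RDMTerm → RDMTerm
  | imp : RDMTerm → RDMTerm → RDMTerm
  | neg : RDMTerm → RDMTerm
  | top : RDMTerm

/-- The value of a term under an assignment. -/
def RDMTerm.eval {A : Type u} [RDMSig A] (e : ℕ → A) : RDMTerm → A
  | .var n => e n
  | .inf s r => s.eval e ⊓ r.eval e
  | .sup s r => s.eval e ⊔ r.eval e
  | .imp s r => (s.eval e ⇨ r.eval e)
  | .neg s => ￢(s.eval e)
  | .top => ⊤

/-- The equation `s ≈ r` is valid in `A`. -/
def EqnValid (A : Type u) [RDMSig A] (s r : RDMTerm) : Prop :=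
  ∀ e : ℕ → A, s.eval e = r.eval e

/-- `A` belongs to the equational class generated by `M`: it satisfies every equation valid
in `M`. -/
def InEqClassOf (M : Type u) [RDMSig M] (A : Type v) [RDMSig A] : Prop :=
  ∀ s r : RDMTerm, EqnValid M s r → EqnValid A s r

/-- Powers of an algebra, with the pointwise operations. -/
instance powSig (M : Type u) [RDMSig M] (I : Type w) : RDMSig (I → M) where
  min a b := fun i => a i ⊓ b i
  max a b := fun i => a i ⊔ b i
  himp a b := fun i => (a i ⇨ b i)
  hnot a := fun i => ￢(a i)
  top := fun _ => ⊤

/-- `A ∈ HSP(M)`: `A` is a homomorphic image of an algebra that embeds into a power of `M`. -/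
def InHSP (M : Type u) [RDMSig M] (A : Type v) [RDMSig A] : Prop :=
  ∃ (I : Type (max u v)) (C : Type (max u v)) (_ : RDMSig C) (e : C → I → M) (g : C → A),
    IsRDMHom e ∧ Function.Injective e ∧ IsRDMHom g ∧ Function.Surjective g

/-! Everything rests on one separation fact: homomorphisms into `Four` separate the points of every
residuated De Morgan lattice (`IsRDML.eq_of_forall_hom`) and of every implicative bilattice
(`IsImplicativeBilattice.eq_of_forall_hom`). Given this, an identity needs to be checked only in
`Four`, by cases.

For separation, consider the elements above `⊤`, or in a bilattice those with `z ⇨ z = z`. They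
contain the axioms of classical implicational logic and are closed under modus ponens. If they omit
`a ⇨ b`, Zorn's lemma extends them to a set `P` with `a ∈ P` and `b ∉ P` on which `⇨` is classical
implication (`exists_prime`). The axioms about antecedents make the other connectives classical on
`P` (`IsPrimeTheory.of_imp_mem`), and recording whether `x` and `￢x` lie in `P` gives a homomorphism
into `Four`.

For the cones, a homomorphism `φ : A → Four` sends `A⁻` into `{f, ⊤}`, and `⟨a, b⟩ ↦ φ a ⊗ ￢φ b` is
a bilattice homomorphism on `A⁻ ⊙ A⁻`. These maps again separate points, which gives the axioms of
the product and the embedding. The same formula with an arbitrary target gives the universal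
extension. `A⁺` with the dual order reduces to `A⁻` through negation. -/

/-! ## Prime theories of classical implication -/

/-- Sets closed under modus ponens that contain the axioms of classical implicational logic. -/
structure IsImplTheory {α : Type u} [HImp α] (F : Set α) : Prop where
  mp : ∀ {x y : α}, (x ⇨ y) ∈ F → x ∈ F → y ∈ F
  k : ∀ x y : α, (x ⇨ (y ⇨ x)) ∈ F
  s : ∀ x y z : α, ((x ⇨ (y ⇨ z)) ⇨ ((x ⇨ y) ⇨ (x ⇨ z))) ∈ F
  peirce : ∀ x y : α, (((x ⇨ y) ⇨ x) ⇨ x) ∈ F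

namespace IsImplTheory

variable {α : Type u} [HImp α] {F : Set α}

theorem mono (hF : IsImplTheory F) {G : Set α} (h : F ⊆ G)
    (mp : ∀ {x y : α}, (x ⇨ y) ∈ G → x ∈ G → y ∈ G) : IsImplTheory G :=
  ⟨mp, fun x y => h (hF.k x y), fun x y z => h (hF.s x y z), fun x y => h (hF.peirce x y)⟩

theorem refl (hF : IsImplTheory F) (x : α) : (x ⇨ x) ∈ F :=
  hF.mp (hF.mp (hF.s x (x ⇨ x) x) (hF.k x (x ⇨ x))) (hF.k x x)

theorem imp_of_mem (hF : IsImplTheory F) (x : α) {y : α} (hy : y ∈ F) : (x ⇨ y) ∈ F :=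
  hF.mp (hF.k y x) hy

/-- The theory generated by `F` and `x`. -/
theorem adjoin (hF : IsImplTheory F) (x : α) : IsImplTheory {y | (x ⇨ y) ∈ F} :=
  hF.mono (fun _ hy => hF.imp_of_mem x hy) fun h h' => hF.mp (hF.mp (hF.s _ _ _) h) h'

theorem exists_maximal (hF : IsImplTheory F) {q : α} (hq : q ∉ F) :
    ∃ P : Set α, F ⊆ P ∧ Maximal (fun G => IsImplTheory G ∧ q ∉ G) P := by
  refine zorn_subset_nonempty {G : Set α | IsImplTheory G ∧ q ∉ G} ?_ F ⟨hF, hq⟩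
  intro c hc hchain hne
  obtain ⟨G₀, hG₀⟩ := hne
  refine ⟨⋃₀ c, ⟨(hc hG₀).1.mono (Set.subset_sUnion_of_mem hG₀) ?_, ?_⟩,
    fun G hG => Set.subset_sUnion_of_mem hG⟩
  · rintro x y ⟨G, hG, hxy⟩ ⟨H, hH, hx⟩
    rcases hchain.total hG hH with h | h
    · exact ⟨H, hH, (hc hH).1.mp (h hxy) hx⟩
    · exact ⟨G, hG, (hc hG).1.mp hxy (h hx)⟩
  · rintro ⟨G, hG, hqG⟩
    exact (hc hG).2 hqG

/-- The theory generated by `F` and `a` omits `b`, so it extends to a theory maximal among those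
omitting `b`. There is no falsum; `b` plays its role, and Peirce's law makes the implication
classical. -/
theorem exists_prime (hF : IsImplTheory F) {a b : α} (hab : (a ⇨ b) ∉ F) :
    ∃ P : Set α, F ⊆ P ∧ a ∈ P ∧ b ∉ P ∧ ∀ x y, (x ⇨ y) ∈ P ↔ (x ∈ P → y ∈ P) := by
  obtain ⟨P, hGP, hP, hmax⟩ := (hF.adjoin a).exists_maximal (q := b) hab
  obtain ⟨hT, hbP⟩ := hP
  have key : ∀ x, x ∉ P → (x ⇨ b) ∈ P := by
    intro x hx
    by_contra hxb
    -- Otherwise adjoining `x` would still omit `b`, and maximality would put `x` in `P`.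
    exact hx (hmax ⟨hT.adjoin x, hxb⟩ (fun _ hy => hT.imp_of_mem x hy) (hT.refl x))
  refine ⟨P, fun y hy => hGP (hF.imp_of_mem a hy), hGP (hF.refl a), hbP, fun x y => ?_⟩
  refine ⟨fun h hx => hT.mp h hx, fun h => ?_⟩
  by_cases hx : x ∈ P
  · exact hT.imp_of_mem x (h hx)
  · by_contra hxy
    have h₁ := key x hx
    have h₂ := key _ hxy
    -- By Peirce's law it suffices to derive `b` from `b ⇨ y`. Chaining `x ⇨ b` with `b ⇨ y` gives
    -- `x ⇨ y`, and `h₂` then gives `b`.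
    refine hbP (hT.mp (hT.peirce b y) ?_)
    have hQ := hT.adjoin (b ⇨ y)
    have e : ∀ {z}, z ∈ P → z ∈ {z | ((b ⇨ y) ⇨ z) ∈ P} := fun hz => hT.imp_of_mem _ hz
    refine hQ.mp (e h₂) (hQ.mp (hQ.mp (hQ.s x b y) (hQ.imp_of_mem x ?_)) (e h₁))
    exact hT.refl (b ⇨ y)

end IsImplTheory

/-! ## The four-element algebra -/

instance : Fintype Four := ⟨{.f, .bot, .top, .t}, fun x => by cases x <;> simp⟩

/-- The bilattice operations of `FOUR`. -/
instance : BilatSig Four where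
  toMin := inferInstance
  toMax := inferInstance
  toHImp := inferInstance
  toHNot := inferInstance
  ktimes
    | .bot, _ => .bot
    | .top, y => y
    | .f, .f => .f
    | .f, .top => .f
    | .f, _ => .bot
    | .t, .t => .t
    | .t, .top => .t
    | .t, _ => .bot
  kplus
    | .top, _ => .top
    | .bot, y => y
    | .f, .f => .f
    | .f, .bot => .f
    | .f, _ => .top
    | .t, .t => .t
    | .t, .bot => .t
    | .t, _ => .top

theorem Four.kTop_eq (x : Four) : kTop x = ⊤ := by cases x <;> rfl

instance : IsRDML Four where
  lattice := ⟨by decide, by decide, by decide, by decide, by decide, by decide⟩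
  distrib := by decide
  neg_neg := by decide
  neg_inf := by decide
  neg_sup := by decide
  rd0 := by decide
  rd1 := by decide
  rd2 := by decide
  rd3 := by decide
  rd4 := by decide
  rd5 := by decide
  rd6 := by decide

instance : IsImplicativeBilattice Four where
  tlattice := ⟨by decide, by decide, by decide, by decide, by decide, by decide⟩
  klattice := ⟨by decide, by decide, by decide, by decide, by decide, by decide⟩
  neg1 := by decide
  neg2 := by decide
  neg3 := by decide
  ib1 := by decide
  ib2 := by decide
  ib2' := by decide
  ib3 := by decide
  ib4 := by decide
  ib4' := by decide
  ib5 := by decide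
  ib6 := by decide

/-! ### `FOUR` as pairs of a truth condition and a falsity condition -/

open Classical in
/-- The element of `FOUR` that is at least true if `p` and at least false if `q`. -/
noncomputable def Four.ofProps (p q : Prop) : Four :=
  if p then (if q then .top else .t) else (if q then .f else .bot)

namespace Four

variable {p q r s : Prop}

theorem ofProps_inf : ofProps (p ∧ r) (q ∨ s) = ofProps p q ⊓ ofProps r s := by
  by_cases p <;> by_cases q <;> by_cases r <;> by_cases s <;> simp_all [ofProps] <;> rfl

theorem ofProps_sup : ofProps (p ∨ r) (q ∧ s) = ofProps p q ⊔ ofProps r s := by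
  by_cases p <;> by_cases q <;> by_cases r <;> by_cases s <;> simp_all [ofProps] <;> rfl

theorem ofProps_ktimes : ofProps (p ∧ r) (q ∧ s) = ofProps p q ⊗ₖ ofProps r s := by
  by_cases p <;> by_cases q <;> by_cases r <;> by_cases s <;> simp_all [ofProps] <;> rfl

theorem ofProps_kplus : ofProps (p ∨ r) (q ∨ s) = ofProps p q ⊕ₖ ofProps r s := by
  by_cases p <;> by_cases q <;> by_cases r <;> by_cases s <;> simp_all [ofProps] <;> rfl

/-- The antecedent matters only through its truth condition, so `q` is arbitrary. -/
theorem ofProps_imp : ofProps (p → r) (p ∧ s) = (ofProps p q ⇨ ofProps r s) := by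
  by_cases p <;> by_cases q <;> by_cases r <;> by_cases s <;> simp_all [ofProps] <;> rfl

theorem ofProps_neg : ofProps q p = ￢(ofProps p q) := by
  by_cases p <;> by_cases q <;> simp_all [ofProps] <;> rfl

theorem ofProps_top (hp : p) (hq : q) : ofProps p q = ⊤ := by
  simp_all [ofProps]; rfl

theorem ofProps_inj (h : ofProps p q = ofProps r s) : (p ↔ r) ∧ (q ↔ s) := by
  by_cases p <;> by_cases q <;> by_cases r <;> by_cases s <;> simp_all [ofProps]

end Four

/-! ## Separation by homomorphisms into `FOUR` -/

/-- The lattice of a pair of operations that satisfies the lattice identities. -/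
abbrev IsLatticePair.toLattice {α : Type u} [Min α] [Max α]
    (h : IsLatticePair (fun x y : α => x ⊓ y) (fun x y : α => x ⊔ y)) : Lattice α :=
  Lattice.mk' h.join_comm h.join_assoc h.meet_comm h.meet_assoc h.join_meet h.meet_join

namespace IsRDML

/-- The distributive lattice of a residuated De Morgan lattice. -/
abbrev distribLattice (A : Type u) [RDMSig A] [IsRDML A] : DistribLattice A :=
  letI := (IsRDML.lattice (A := A)).toLattice
  DistribLattice.ofInfSupLe fun a b c => (IsRDML.distrib a b c).le

section

attribute [local instance] distribLattice

variable {A : Type u} [RDMSig A] [IsRDML A] {x y z : A}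

theorem imp_anti (h : x ≤ y) : (y ⇨ z) ≤ (x ⇨ z) := by
  have h' := rd4 x y z
  rw [sup_eq_right.2 h] at h'
  exact inf_eq_right.1 h'.symm

theorem imp_inf_top : ((x ⊓ ⊤) ⇨ z) = (x ⇨ z) := by rw [← rd2, rd1]

theorem imp_of_top_le (h : ⊤ ≤ x) : (x ⇨ z) = z := by
  rw [← imp_inf_top, inf_eq_right.2 h, rd1]

theorem top_le_imp_top : ⊤ ≤ (x ⇨ ⊤) := by
  rw [← imp_inf_top]
  exact (rd1 (⊤ : A)).ge.trans (imp_anti inf_le_right)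

/-- RD5 at `⊤` and `x` has antecedent `x ⊓ (￢x ⇨ ⊤)`. Currying it leaves `x ⇨ x`, since the factor
`￢x ⇨ ⊤` lies above `⊤` and such antecedents can be dropped. -/
theorem top_le_imp_self : ⊤ ≤ (x ⇨ x) := by
  have h := rd5 (⊤ : A) x
  rw [rd1, ← rd0, inf_comm x, ← rd2, imp_of_top_le top_le_imp_top] at h
  exact inf_eq_left.1 h

theorem top_le_imp_of_top_le (h : ⊤ ≤ y) : ⊤ ≤ (x ⇨ y) := by
  have e : (x ⇨ y) = ((y ⊓ x) ⇨ y) := by rw [← rd2, imp_of_top_le h]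
  rw [e]
  exact top_le_imp_self.trans (imp_anti inf_le_left)

/-- The residuation property. -/
theorem top_le_imp_iff : ⊤ ≤ (x ⇨ y) ↔ x ⊓ ⊤ ≤ y := by
  constructor
  · intro h
    -- With `x ⊓ ⊤` in place of `x`, the contraposed conjunct in RD5 has consequent `￢x ⊔ ⊤`, so it
    -- lies above `⊤` automatically and only `x ⇨ y` has to be supplied.
    have h₁ := rd5 (x ⊓ ⊤) y
    rw [imp_of_top_le] at h₁
    · exact inf_eq_left.1 h₁
    · refine le_inf (by rwa [imp_inf_top]) (top_le_imp_of_top_le ?_)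
      rw [neg_inf, ← rd0]
      exact le_sup_right
  · intro h
    rw [← imp_inf_top]
    exact top_le_imp_self.trans (imp_anti h)

theorem top_le_of_imp (h : ⊤ ≤ (x ⇨ y)) (hx : ⊤ ≤ x) : ⊤ ≤ y := by
  rwa [imp_of_top_le hx] at h

theorem inf_imp_inf_top_le : x ⊓ (x ⇨ y) ⊓ ⊤ ≤ y := by
  rw [← top_le_imp_iff, inf_comm, ← rd2]
  exact top_le_imp_self

/-- Residuation turns the first two axioms into lattice inequalities, and Peirce's law is RD3. In
`s` the bound by `⊤` is carried along because modus ponens holds as an inequality only below `⊤`. -/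
theorem isImplTheory (A : Type u) [RDMSig A] [IsRDML A] : IsImplTheory {z : A | ⊤ ≤ z} where
  mp h hx := top_le_of_imp h hx
  k x y := by
    rw [Set.mem_ofPred_eq, rd2, top_le_imp_iff]
    exact inf_le_left.trans inf_le_left
  s x y z := by
    rw [Set.mem_ofPred_eq, rd2, rd2, top_le_imp_iff]
    set a := (x ⇨ (y ⇨ z)) ⊓ (x ⇨ y) ⊓ x ⊓ ⊤ with ha
    have h₁ : a ≤ x := inf_le_left.trans inf_le_right
    have h₂ : a ≤ (x ⇨ y) := inf_le_left.trans (inf_le_left.trans inf_le_right)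
    have h₃ : a ≤ (x ⇨ (y ⇨ z)) := inf_le_left.trans (inf_le_left.trans inf_le_left)
    have h₀ : a ≤ ⊤ := inf_le_right
    have h₄ : a ≤ y := (le_inf (le_inf h₁ h₂) h₀).trans inf_imp_inf_top_le
    have h₅ : a ≤ (y ⇨ z) := (le_inf (le_inf h₁ h₃) h₀).trans inf_imp_inf_top_le
    exact (le_inf (le_inf h₄ h₅) h₀).trans inf_imp_inf_top_le
  peirce x y := inf_eq_left.1 (rd3 x y)

end

end IsRDML

/-! ### Prime theories and their valuations in `FOUR` -/

/-- A set of elements in which the connectives behave classically. -/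
structure IsPrimeTheory {α : Type u} [Min α] [Max α] [HImp α] [HNot α] (P : Set α) : Prop where
  inf_mem : ∀ x y, x ⊓ y ∈ P ↔ x ∈ P ∧ y ∈ P
  sup_mem : ∀ x y, x ⊔ y ∈ P ↔ x ∈ P ∨ y ∈ P
  imp_mem : ∀ x y, (x ⇨ y) ∈ P ↔ (x ∈ P → y ∈ P)
  neg_imp_mem : ∀ x y, ￢(x ⇨ y) ∈ P ↔ x ∈ P ∧ ￢y ∈ P

/-- The map into `FOUR` that is given by a prime theory. -/
noncomputable def fourOf {α : Type u} [HNot α] (P : Set α) (x : α) : Four :=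
  Four.ofProps (x ∈ P) (￢x ∈ P)

/-- Take `z` to be `x` and then `y`: `x ⇨ x` and `y ⇨ y` are always in `P`. This turns equations
between antecedents into membership conditions. -/
theorem mem_iff_mem_of_imp_eq {α : Type u} [HImp α] {P : Set α}
    (imp_mem : ∀ x y, (x ⇨ y) ∈ P ↔ (x ∈ P → y ∈ P)) {x y : α} (h : ∀ z, (x ⇨ z) = (y ⇨ z)) : x ∈ P ↔ y ∈ P := by
  have h₁ := congrArg (· ∈ P) (h x)
  have h₂ := congrArg (· ∈ P) (h y)
  simp only [imp_mem, eq_iff_iff] at h₁ h₂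
  tauto

section

variable {α : Type u} [Min α] [Max α] [HImp α] [HNot α] {P : Set α}

/-- The element `q` acts as falsum: `z ⇨ q` is in `P` exactly when `z` is not. The three laws used
are common to both kinds of algebra. -/
theorem IsPrimeTheory.of_imp_mem {q : α} (hq : q ∉ P)
    (imp_mem : ∀ x y, (x ⇨ y) ∈ P ↔ (x ∈ P → y ∈ P))
    (rd2 : ∀ x y z : α, (x ⇨ (y ⇨ z)) = ((x ⊓ y) ⇨ z))
    (rd4 : ∀ x y z : α, ((x ⊔ y) ⇨ z) = (x ⇨ z) ⊓ (y ⇨ z))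
    (rd6 : ∀ x y z : α, ((￢(x ⇨ y)) ⇨ z) = ((x ⊓ ￢y) ⇨ z)) : IsPrimeTheory P := by
  have inf_mem : ∀ x y, x ⊓ y ∈ P ↔ x ∈ P ∧ y ∈ P := by
    intro x y
    have h₁ := congrArg (· ∈ P) (rd2 x y (x ⊓ y))
    have h₂ := congrArg (· ∈ P) (rd2 x y q)
    simp only [imp_mem, eq_iff_iff] at h₁ h₂
    tauto
  refine ⟨inf_mem, fun x y => ?_, imp_mem, fun x y => ?_⟩
  · have h₁ := congrArg (· ∈ P) (rd4 x y (x ⊔ y))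
    have h₂ := congrArg (· ∈ P) (rd4 x y q)
    simp only [imp_mem, inf_mem, eq_iff_iff] at h₁ h₂
    tauto
  · rw [mem_iff_mem_of_imp_eq imp_mem (rd6 x y), inf_mem]

end

theorem IsPrimeTheory.isRDMHom {A : Type u} [RDMSig A] [IsRDML A] {P : Set A}
    (hP : IsPrimeTheory P) (htop : ⊤ ∈ P) : IsRDMHom (fourOf P) where
  map_inf x y := by
    rw [fourOf, hP.inf_mem, IsRDML.neg_inf, hP.sup_mem, Four.ofProps_inf]; rfl
  map_sup x y := by
    rw [fourOf, hP.sup_mem, IsRDML.neg_sup, hP.inf_mem, Four.ofProps_sup]; rfl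
  map_imp x y := by
    rw [fourOf, hP.imp_mem, hP.neg_imp_mem, Four.ofProps_imp (q := ￢x ∈ P)]; rfl
  map_neg x := by rw [fourOf, IsRDML.neg_neg, Four.ofProps_neg]; rfl
  map_top := by
    -- Since `⊤` is its own negation, it is both true and false.
    rw [fourOf, ← IsRDML.rd0]
    exact Four.ofProps_top htop htop

/-- Two elements of a residuated De Morgan lattice that agree under every homomorphism into
`FOUR` are equal. -/
theorem IsRDML.eq_of_forall_hom {A : Type u} [RDMSig A] [IsRDML A] {a b : A}
    (h : ∀ φ : A → Four, IsRDMHom φ → φ a = φ b) : a = b := by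
  let := distribLattice A
  have key : ∀ P : Set A, IsPrimeTheory P → ⊤ ∈ P → (a ∈ P ↔ b ∈ P) ∧ (￢a ∈ P ↔ ￢b ∈ P) :=
    fun P hP ht => Four.ofProps_inj (h _ (hP.isRDMHom ht))
  have sep : ∀ {x y : A}, (∀ P : Set A, IsPrimeTheory P → ⊤ ∈ P → x ∈ P → y ∈ P) →
      x ⊓ ⊤ ≤ y := by
    intro x y hxy
    rw [← top_le_imp_iff]
    by_contra hn
    obtain ⟨P, hDP, hx, hy, hP⟩ := (isImplTheory A).exists_prime (a := x) (b := y) hn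
    exact hy (hxy P (.of_imp_mem hy hP rd2 rd4 rd6) (hDP (le_refl (⊤ : A))) hx)
  have h₁ : a ⊓ ⊤ = b ⊓ ⊤ := le_antisymm
    (le_inf (sep fun P hP ht => (key P hP ht).1.1) inf_le_right)
    (le_inf (sep fun P hP ht => (key P hP ht).1.2) inf_le_right)
  have h₂ : ￢a ⊓ ⊤ = ￢b ⊓ ⊤ := le_antisymm
    (le_inf (sep fun P hP ht => (key P hP ht).2.1) inf_le_right)
    (le_inf (sep fun P hP ht => (key P hP ht).2.2) inf_le_right)
  -- Theories containing `⊤` only compare meets with `⊤`. The negations supply the joins with `⊤`,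
  -- and distributivity then cancels `⊤`.
  have h₃ : a ⊔ ⊤ = b ⊔ ⊤ := by
    have := congrArg (￢·) h₂
    simpa only [neg_inf, neg_neg, ← rd0] using this
  exact eq_of_inf_eq_sup_eq h₁ h₃

/-! ### Separation for implicative bilattices -/

namespace IsImplicativeBilattice

section

/-- The truth lattice of an implicative bilattice. -/
abbrev truthLattice (B : Type u) [BilatSig B] [IsImplicativeBilattice B] : Lattice B :=
  (tlattice (B := B)).toLattice

attribute [local instance] truthLattice

variable {B : Type u} [BilatSig B] [IsImplicativeBilattice B] {x y z : B}

theorem neg_anti (h : x ≤ y) : ￢y ≤ ￢x := inf_eq_left.1 (neg1 x y (inf_eq_left.2 h))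

theorem neg_inf (x y : B) : ￢(x ⊓ y) = ￢x ⊔ ￢y := by
  refine le_antisymm ?_ (sup_le (neg_anti inf_le_left) (neg_anti inf_le_right))
  rw [neg3 (￢x ⊔ ￢y)]
  refine neg_anti (le_inf ?_ ?_)
  · conv_rhs => rw [neg3 x]
    exact neg_anti le_sup_left
  · conv_rhs => rw [neg3 y]
    exact neg_anti le_sup_right

theorem neg_sup (x y : B) : ￢(x ⊔ y) = ￢x ⊓ ￢y := by
  rw [neg3 (￢x ⊓ ￢y), neg_inf, ← neg3, ← neg3]

/-- By IB1 such an `x` acts as the identity on consequents. Inserting it as an antecedent below `y`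
and absorbing `y` by IB2 shows the same for `y`. -/
theorem mem_of_le (hx : (x ⇨ x) = x) (h : x ≤ y) : (y ⇨ y) = y := by
  have key : ∀ u, (x ⇨ u) = u := fun u => by rw [← hx, ib1]
  have : ∀ u, (y ⇨ u) = u := fun u => by
    calc (y ⇨ u) = (y ⇨ (x ⇨ u)) := by rw [key]
      _ = u := by rw [ib2, inf_eq_right.2 h, key]
  exact this y

theorem imp_anti (h : x ≤ y) : (y ⇨ z) ≤ (x ⇨ z) := by
  have h' := ib4 x y z
  rw [sup_eq_right.2 h] at h'
  exact inf_eq_right.1 h'.symm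

/-- When `x ⇨ y` is designated, IB5 reduces to `x ≤ x ⊗ₖ y`, and IB2 permits `⊗ₖ` in the antecedent.
This is modus ponens under a common hypothesis. -/
theorem imp_imp_le (h : (x ⇨ y) ⇨ (x ⇨ y) = (x ⇨ y)) : (x ⇨ (y ⇨ z)) ≤ (x ⇨ z) := by
  have h₁ := ib5 x y
  rw [← h, ib1] at h₁
  rw [ib2, ib2']
  exact imp_anti (inf_eq_left.1 h₁)

/-- The designated elements form a theory. -/
theorem isImplTheory (B : Type u) [BilatSig B] [IsImplicativeBilattice B] :
    IsImplTheory {z : B | (z ⇨ z) = z} := by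
  have one : ∀ x : B, (x ⇨ x) ∈ {z : B | (z ⇨ z) = z} := fun x => ib1 x _
  have mp : ∀ {x y : B}, (x ⇨ y) ∈ {z : B | (z ⇨ z) = z} → x ∈ {z : B | (z ⇨ z) = z} →
      y ∈ {z : B | (z ⇨ z) = z} := by
    intro x y h hx
    rw [Set.mem_ofPred_eq] at hx
    rwa [← hx, ib1] at h
  have up : ∀ {x y : B}, x ∈ {z : B | (z ⇨ z) = z} → x ≤ y → y ∈ {z : B | (z ⇨ z) = z} :=
    fun hx h => mem_of_le hx h
  have imp_of_le : ∀ {x y : B}, x ≤ y → (x ⇨ y) ∈ {z : B | (z ⇨ z) = z} :=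
    fun h => up (one _) (imp_anti h)
  have k : ∀ x y : B, (x ⇨ (y ⇨ x)) ∈ {z : B | (z ⇨ z) = z} := fun x y => by
    rw [ib2]
    exact imp_of_le inf_le_left
  have imp_mp : ∀ {a x y : B}, (a ⇨ x) ∈ {z : B | (z ⇨ z) = z} →
      (a ⇨ (x ⇨ y)) ∈ {z : B | (z ⇨ z) = z} → (a ⇨ y) ∈ {z : B | (z ⇨ z) = z} :=
    fun h h' => up h' (imp_imp_le h)
  refine ⟨mp, k, fun x y z => ?_, fun x y => ?_⟩
  · rw [ib2, ib2]
    have h₁ : (x ⇨ (y ⇨ z)) ⊓ (x ⇨ y) ⊓ x ≤ x := inf_le_right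
    have h₂ : (x ⇨ (y ⇨ z)) ⊓ (x ⇨ y) ⊓ x ≤ (x ⇨ y) := inf_le_left.trans inf_le_right
    have h₃ : (x ⇨ (y ⇨ z)) ⊓ (x ⇨ y) ⊓ x ≤ (x ⇨ (y ⇨ z)) := inf_le_left.trans inf_le_left
    have hx := imp_of_le h₁
    exact imp_mp (imp_mp hx (imp_of_le h₂)) (imp_mp hx (imp_of_le h₃))
  · rw [ib3]
    exact one x

end

/-- A monotone involution is an order automorphism. It is applied to negation in the knowledge
order. -/
theorem map_lattice_of_involutive {α : Type u} [Lattice α] {f : α → α} (hf : f.Involutive)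
    (hm : ∀ x y, x ⊓ y = x → f x ⊓ f y = f x) (x y : α) :
    f (x ⊓ y) = f x ⊓ f y ∧ f (x ⊔ y) = f x ⊔ f y := by
  have mono : Monotone f := fun x y h => inf_eq_left.1 (hm x y (inf_eq_left.2 h))
  let g : α ≃o α := ⟨hf.toPerm, fun {a b} => ⟨fun h => by simpa [hf a, hf b] using mono h,
    fun h => mono h⟩⟩
  exact ⟨map_inf g x y, map_sup g x y⟩

variable {B : Type u} [BilatSig B] [IsImplicativeBilattice B]

/-- The lattice of the knowledge order. -/
abbrev knowledgeLattice (B : Type u) [BilatSig B] [IsImplicativeBilattice B] : Lattice B :=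
  @IsLatticePair.toLattice B ⟨BilatSig.ktimes⟩ ⟨BilatSig.kplus⟩ klattice

theorem neg_ktimes (x y : B) : ￢(x ⊗ₖ y) = ￢x ⊗ₖ ￢y :=
  (@map_lattice_of_involutive B (knowledgeLattice B) _ (fun x => (neg3 x).symm) neg2 x y).1

theorem neg_kplus (x y : B) : ￢(x ⊕ₖ y) = ￢x ⊕ₖ ￢y :=
  (@map_lattice_of_involutive B (knowledgeLattice B) _ (fun x => (neg3 x).symm) neg2 x y).2

/-- By IB2 and IB4 the knowledge operations agree as antecedents with the truth operations, so
membership in `P` is the same. Negation preserves them, so the falsity side does not swap meet and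
join. -/
theorem isBilatHom_fourOf {P : Set B} (hP : IsPrimeTheory P) : IsBilatHom (fourOf P) where
  map_inf x y := by
    rw [fourOf, hP.inf_mem, neg_inf, hP.sup_mem, Four.ofProps_inf]; rfl
  map_sup x y := by
    rw [fourOf, hP.sup_mem, neg_sup, hP.inf_mem, Four.ofProps_sup]; rfl
  map_ktimes x y := by
    have e : ∀ x y : B, x ⊗ₖ y ∈ P ↔ x ∈ P ∧ y ∈ P := fun x y => by
      rw [← mem_iff_mem_of_imp_eq hP.imp_mem (ib2' x y), hP.inf_mem]
    rw [fourOf, e, neg_ktimes, e, Four.ofProps_ktimes]; rfl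
  map_kplus x y := by
    have e : ∀ x y : B, x ⊕ₖ y ∈ P ↔ x ∈ P ∨ y ∈ P := fun x y => by
      rw [← mem_iff_mem_of_imp_eq hP.imp_mem fun z => (ib4 x y z).trans (ib4' x y z), hP.sup_mem]
    rw [fourOf, e, neg_kplus, e, Four.ofProps_kplus]; rfl
  map_imp x y := by
    rw [fourOf, hP.imp_mem, hP.neg_imp_mem, Four.ofProps_imp (q := ￢x ∈ P)]; rfl
  map_neg x := by rw [fourOf, ← neg3, Four.ofProps_neg]; rfl

/-- Two elements of an implicative bilattice that agree under every homomorphism into `FOUR` are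
equal. -/
theorem eq_of_forall_hom {a b : B} (h : ∀ φ : B → Four, IsBilatHom φ → φ a = φ b) : a = b := by
  let := truthLattice B
  have key : ∀ P : Set B, IsPrimeTheory P → (a ∈ P ↔ b ∈ P) ∧ (￢a ∈ P ↔ ￢b ∈ P) :=
    fun P hP => Four.ofProps_inj (h _ (isBilatHom_fourOf hP))
  have sep : ∀ {x y : B}, (∀ P : Set B, IsPrimeTheory P → x ∈ P → y ∈ P) → x ≤ x ⊗ₖ y := by
    intro x y hxy
    have h₁ : ((x ⇨ y) ⇨ (x ⇨ y)) = (x ⇨ y) := by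
      by_contra hn
      obtain ⟨P, hDP, hx, hy, hP⟩ := (isImplTheory B).exists_prime (a := x) (b := y) hn
      exact hy (hxy P (.of_imp_mem hy hP ib2 ib4 ib6) hx)
    have h₂ := ib5 x y
    rw [← h₁, ib1] at h₂
    exact inf_eq_left.1 h₂
  -- Separation of negations yields the reverse truth inequality, so `a = a ⊗ₖ b` and symmetrically
  -- for `b`; distributivity is not needed.
  have neg_le : ∀ {x y : B}, ￢x ≤ ￢x ⊗ₖ ￢y → x ⊗ₖ y ≤ x := fun {x y} h => by
    have := neg_anti h
    rwa [neg_ktimes, ← neg3, ← neg3] at this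
  have h₁ : a = a ⊗ₖ b := le_antisymm (sep fun P hP => (key P hP).1.1)
    (neg_le (sep fun P hP => (key P hP).2.1))
  have h₂ : b = b ⊗ₖ a := le_antisymm (sep fun P hP => (key P hP).1.2)
    (neg_le (sep fun P hP => (key P hP).2.2))
  rw [h₁, klattice.meet_comm, ← h₂]

end IsImplicativeBilattice

/-! ## Transfer of identities along homomorphisms into `FOUR` -/

theorem IsRDML.of_forall_hom {A : Type u} [RDMSig A]
    (h : ∀ a b : A, (∀ φ : A → Four, IsRDMHom φ → φ a = φ b) → a = b) : IsRDML A where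
  lattice :=
    { meet_comm := fun x y => h _ _ fun φ hφ => by
        simp only [hφ.map_inf]; exact (IsRDML.lattice (A := Four)).meet_comm _ _
      join_comm := fun x y => h _ _ fun φ hφ => by
        simp only [hφ.map_sup]; exact (IsRDML.lattice (A := Four)).join_comm _ _
      meet_assoc := fun x y z => h _ _ fun φ hφ => by
        simp only [hφ.map_inf]; exact (IsRDML.lattice (A := Four)).meet_assoc _ _ _
      join_assoc := fun x y z => h _ _ fun φ hφ => by
        simp only [hφ.map_sup]; exact (IsRDML.lattice (A := Four)).join_assoc _ _ _
      meet_join := fun x y => h _ _ fun φ hφ => by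
        simp only [hφ.map_inf, hφ.map_sup]; exact (IsRDML.lattice (A := Four)).meet_join _ _
      join_meet := fun x y => h _ _ fun φ hφ => by
        simp only [hφ.map_inf, hφ.map_sup]; exact (IsRDML.lattice (A := Four)).join_meet _ _ }
  distrib x y z := h _ _ fun φ hφ => by
    simp only [hφ.map_inf, hφ.map_sup]; exact IsRDML.distrib _ _ _
  neg_neg x := h _ _ fun φ hφ => by
    simp only [hφ.map_neg]; exact IsRDML.neg_neg _
  neg_inf x y := h _ _ fun φ hφ => by
    simp only [hφ.map_inf, hφ.map_sup, hφ.map_neg]; exact IsRDML.neg_inf _ _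
  neg_sup x y := h _ _ fun φ hφ => by
    simp only [hφ.map_inf, hφ.map_sup, hφ.map_neg]; exact IsRDML.neg_sup _ _
  rd0 := h _ _ fun φ hφ => by
    simp only [hφ.map_neg, hφ.map_top]; exact IsRDML.rd0
  rd1 x := h _ _ fun φ hφ => by
    simp only [hφ.map_imp, hφ.map_top]; exact IsRDML.rd1 _
  rd2 x y z := h _ _ fun φ hφ => by
    simp only [hφ.map_imp, hφ.map_inf]; exact IsRDML.rd2 _ _ _
  rd3 x y := h _ _ fun φ hφ => by
    simp only [hφ.map_imp, hφ.map_inf, hφ.map_top]; exact IsRDML.rd3 _ _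
  rd4 x y z := h _ _ fun φ hφ => by
    simp only [hφ.map_imp, hφ.map_inf, hφ.map_sup]; exact IsRDML.rd4 _ _ _
  rd5 x y := h _ _ fun φ hφ => by
    simp only [hφ.map_imp, hφ.map_inf, hφ.map_neg]; exact IsRDML.rd5 _ _
  rd6 x y z := h _ _ fun φ hφ => by
    simp only [hφ.map_imp, hφ.map_inf, hφ.map_neg]; exact IsRDML.rd6 _ _ _

theorem IsImplicativeBilattice.of_forall_hom {B : Type u} [BilatSig B]
    (h : ∀ a b : B, (∀ φ : B → Four, IsBilatHom φ → φ a = φ b) → a = b) :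
    IsImplicativeBilattice B where
  tlattice :=
    { meet_comm := fun x y => h _ _ fun φ hφ => by
        simp only [hφ.map_inf]; exact (tlattice (B := Four)).meet_comm _ _
      join_comm := fun x y => h _ _ fun φ hφ => by
        simp only [hφ.map_sup]; exact (tlattice (B := Four)).join_comm _ _
      meet_assoc := fun x y z => h _ _ fun φ hφ => by
        simp only [hφ.map_inf]; exact (tlattice (B := Four)).meet_assoc _ _ _
      join_assoc := fun x y z => h _ _ fun φ hφ => by
        simp only [hφ.map_sup]; exact (tlattice (B := Four)).join_assoc _ _ _
      meet_join := fun x y => h _ _ fun φ hφ => by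
        simp only [hφ.map_inf, hφ.map_sup]; exact (tlattice (B := Four)).meet_join _ _
      join_meet := fun x y => h _ _ fun φ hφ => by
        simp only [hφ.map_inf, hφ.map_sup]; exact (tlattice (B := Four)).join_meet _ _ }
  klattice :=
    { meet_comm := fun x y => h _ _ fun φ hφ => by
        simp only [hφ.map_ktimes]; exact (klattice (B := Four)).meet_comm _ _
      join_comm := fun x y => h _ _ fun φ hφ => by
        simp only [hφ.map_kplus]; exact (klattice (B := Four)).join_comm _ _
      meet_assoc := fun x y z => h _ _ fun φ hφ => by
        simp only [hφ.map_ktimes]; exact (klattice (B := Four)).meet_assoc _ _ _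
      join_assoc := fun x y z => h _ _ fun φ hφ => by
        simp only [hφ.map_kplus]; exact (klattice (B := Four)).join_assoc _ _ _
      meet_join := fun x y => h _ _ fun φ hφ => by
        simp only [hφ.map_ktimes, hφ.map_kplus]; exact (klattice (B := Four)).meet_join _ _
      join_meet := fun x y => h _ _ fun φ hφ => by
        simp only [hφ.map_ktimes, hφ.map_kplus]; exact (klattice (B := Four)).join_meet _ _ }
  -- Not an identity, but its premise is an equation and survives every homomorphism.
  neg1 x y hxy := h _ _ fun φ hφ => by
    have := congrArg φ hxy
    simp only [hφ.map_inf, hφ.map_neg] at this ⊢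
    exact neg1 _ _ this
  neg2 x y hxy := h _ _ fun φ hφ => by
    have := congrArg φ hxy
    simp only [hφ.map_ktimes, hφ.map_neg] at this ⊢
    exact neg2 _ _ this
  neg3 x := h _ _ fun φ hφ => by
    simp only [hφ.map_neg]; exact neg3 _
  ib1 x y := h _ _ fun φ hφ => by
    simp only [hφ.map_imp]; exact ib1 _ _
  ib2 x y z := h _ _ fun φ hφ => by
    simp only [hφ.map_imp, hφ.map_inf]; exact ib2 _ _ _
  ib2' x y z := h _ _ fun φ hφ => by
    simp only [hφ.map_imp, hφ.map_inf, hφ.map_ktimes]; exact ib2' _ _ _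
  ib3 x y := h _ _ fun φ hφ => by
    simp only [hφ.map_imp]; exact ib3 _ _
  ib4 x y z := h _ _ fun φ hφ => by
    simp only [hφ.map_imp, hφ.map_inf, hφ.map_sup]; exact ib4 _ _ _
  ib4' x y z := h _ _ fun φ hφ => by
    simp only [hφ.map_imp, hφ.map_inf, hφ.map_kplus]; exact ib4' _ _ _
  ib5 x y := h _ _ fun φ hφ => by
    simp only [hφ.map_imp, hφ.map_inf, hφ.map_ktimes]; exact ib5 _ _
  ib6 x y z := h _ _ fun φ hφ => by
    simp only [hφ.map_imp, hφ.map_inf, hφ.map_neg]; exact ib6 _ _ _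

/-! ### Subreducts of implicative bilattices -/

theorem IsReductHom.isRDMHom {A : Type u} {B : Type v} [RDMSig A] [BilatSig B] {f : A → B}
    (hf : IsReductHom f) {φ : B → Four} (hφ : IsBilatHom φ) : IsRDMHom (φ ∘ f) where
  map_inf x y := by simp only [Function.comp, hf.map_inf, hφ.map_inf]
  map_sup x y := by simp only [Function.comp, hf.map_sup, hφ.map_sup]
  map_imp x y := by simp only [Function.comp, hf.map_imp, hφ.map_imp]
  map_neg x := by simp only [Function.comp, hf.map_neg, hφ.map_neg]
  map_top := by
    rw [Function.comp, hf.map_top (f ⊤), kTop, hφ.map_kplus, hφ.map_neg, hφ.map_imp]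
    exact Four.kTop_eq _

/-- Subreducts of implicative bilattices are residuated De Morgan lattices. -/
theorem IsReductHom.isRDML {A : Type u} {B : Type v} [RDMSig A] [BilatSig B]
    [IsImplicativeBilattice B] {f : A → B} (hf : IsReductHom f) (hinj : Function.Injective f) :
    IsRDML A :=
  .of_forall_hom fun _ _ h => hinj <| IsImplicativeBilattice.eq_of_forall_hom fun _ hφ =>
    h _ (hf.isRDMHom hφ)

/-- The power of the bilattice `FOUR`. -/
abbrev fourPowSig (I : Type w) : BilatSig (I → Four) where
  toMin := inferInstance
  toMax := inferInstance
  toHImp := inferInstance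
  toHNot := inferInstance
  ktimes a b := fun i => a i ⊗ₖ b i
  kplus a b := fun i => a i ⊕ₖ b i

/-- Evaluation at all homomorphisms into `Four` embeds `A` in a power of `Four`, which is itself
separated by its coordinates. The lift of the index set only adjusts the universe. -/
theorem IsRDML.exists_reductHom (A : Type u) [RDMSig A] [IsRDML A] :
    ∃ (B : Type (max u v)) (_ : BilatSig B) (_ : IsImplicativeBilattice B) (f : A → B),
      IsReductHom f ∧ Function.Injective f := by
  let I := ULift.{v} {φ : A → Four // IsRDMHom φ}
  let := fourPowSig I
  refine ⟨I → Four, inferInstance, ?_, fun a i => i.down.1 a, ?_, ?_⟩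
  · exact .of_forall_hom fun a b h => funext fun i => h (fun a => a i)
      ⟨fun _ _ => rfl, fun _ _ => rfl, fun _ _ => rfl, fun _ _ => rfl, fun _ _ => rfl,
        fun _ => rfl⟩
  · exact ⟨fun _ _ => funext fun i => i.down.2.map_inf _ _,
      fun _ _ => funext fun i => i.down.2.map_sup _ _,
      fun _ _ => funext fun i => i.down.2.map_imp _ _,
      fun _ => funext fun i => i.down.2.map_neg _,
      fun b => funext fun i => i.down.2.map_top.trans (Four.kTop_eq (b i)).symm⟩
  · exact fun a b h => IsRDML.eq_of_forall_hom fun φ hφ => congrFun h ⟨φ, hφ⟩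

/-! ## The variety generated by `FOUR` -/

theorem IsRDMHom.map_eval {A : Type u} {C : Type v} [RDMSig A] [RDMSig C] {f : A → C}
    (hf : IsRDMHom f) (e : ℕ → A) (s : RDMTerm) : f (s.eval e) = s.eval (f ∘ e) := by
  induction s with
  | var n => rfl
  | inf s r hs hr => simp only [RDMTerm.eval, hf.map_inf, hs, hr]
  | sup s r hs hr => simp only [RDMTerm.eval, hf.map_sup, hs, hr]
  | imp s r hs hr => simp only [RDMTerm.eval, hf.map_imp, hs, hr]
  | neg s hs => simp only [RDMTerm.eval, hf.map_neg, hs]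
  | top => exact hf.map_top

theorem IsRDML.inEqClassOf (A : Type u) [RDMSig A] [IsRDML A] : InEqClassOf Four A :=
  fun s r h e => eq_of_forall_hom fun φ hφ => by
    rw [hφ.map_eval, hφ.map_eval, h]

/-- An assignment of values to the first three variables. -/
def assign₃ {A : Type u} (x y z : A) : ℕ → A
  | 0 => x
  | 1 => y
  | _ => z

open RDMTerm in
theorem InEqClassOf.isRDML {A : Type u} [RDMSig A] (h : InEqClassOf Four A) : IsRDML A where
  lattice :=
    { meet_comm := fun x y => h (inf (var 0) (var 1)) (inf (var 1) (var 0))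
        (fun _ => (IsRDML.lattice (A := Four)).meet_comm _ _) (assign₃ x y y)
      join_comm := fun x y => h (sup (var 0) (var 1)) (sup (var 1) (var 0))
        (fun _ => (IsRDML.lattice (A := Four)).join_comm _ _) (assign₃ x y y)
      meet_assoc := fun x y z => h (inf (inf (var 0) (var 1)) (var 2))
        (inf (var 0) (inf (var 1) (var 2)))
        (fun _ => (IsRDML.lattice (A := Four)).meet_assoc _ _ _) (assign₃ x y z)
      join_assoc := fun x y z => h (sup (sup (var 0) (var 1)) (var 2))
        (sup (var 0) (sup (var 1) (var 2)))
        (fun _ => (IsRDML.lattice (A := Four)).join_assoc _ _ _) (assign₃ x y z)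
      meet_join := fun x y => h (inf (var 0) (sup (var 0) (var 1))) (var 0)
        (fun _ => (IsRDML.lattice (A := Four)).meet_join _ _) (assign₃ x y y)
      join_meet := fun x y => h (sup (var 0) (inf (var 0) (var 1))) (var 0)
        (fun _ => (IsRDML.lattice (A := Four)).join_meet _ _) (assign₃ x y y) }
  distrib x y z := h (inf (var 0) (sup (var 1) (var 2)))
    (sup (inf (var 0) (var 1)) (inf (var 0) (var 2)))
    (fun _ => IsRDML.distrib _ _ _) (assign₃ x y z)
  neg_neg x := h (neg (neg (var 0))) (var 0) (fun _ => IsRDML.neg_neg _) (assign₃ x x x)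
  neg_inf x y := h (neg (inf (var 0) (var 1))) (sup (neg (var 0)) (neg (var 1)))
    (fun _ => IsRDML.neg_inf _ _) (assign₃ x y y)
  neg_sup x y := h (neg (sup (var 0) (var 1))) (inf (neg (var 0)) (neg (var 1)))
    (fun _ => IsRDML.neg_sup _ _) (assign₃ x y y)
  rd0 := h top (neg top) (fun _ => IsRDML.rd0) fun _ => ⊤
  rd1 x := h (imp top (var 0)) (var 0) (fun _ => IsRDML.rd1 _) (assign₃ x x x)
  rd2 x y z := h (imp (var 0) (imp (var 1) (var 2))) (imp (inf (var 0) (var 1)) (var 2))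
    (fun _ => IsRDML.rd2 _ _ _) (assign₃ x y z)
  rd3 x y := h (inf top (imp (imp (imp (var 0) (var 1)) (var 0)) (var 0))) top
    (fun _ => IsRDML.rd3 _ _) (assign₃ x y y)
  rd4 x y z := h (imp (sup (var 0) (var 1)) (var 2))
    (inf (imp (var 0) (var 2)) (imp (var 1) (var 2)))
    (fun _ => IsRDML.rd4 _ _ _) (assign₃ x y z)
  rd5 x y := h (inf (var 0) (imp (inf (imp (var 0) (var 1)) (imp (neg (var 1)) (neg (var 0))))
    (var 1))) (var 0) (fun _ => IsRDML.rd5 _ _) (assign₃ x y y)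
  rd6 x y z := h (imp (neg (imp (var 0) (var 1))) (var 2))
    (imp (inf (var 0) (neg (var 1))) (var 2))
    (fun _ => IsRDML.rd6 _ _ _) (assign₃ x y z)

/-- `A` itself embeds in a power by evaluation, so the surjection can be the identity. -/
theorem IsRDML.inHSP (A : Type u) [RDMSig A] [IsRDML A] : InHSP Four A :=
  ⟨{φ : A → Four // IsRDMHom φ}, A, inferInstance, fun a i => i.1 a, id,
    ⟨fun _ _ => funext fun i => i.2.map_inf _ _, fun _ _ => funext fun i => i.2.map_sup _ _,
      fun _ _ => funext fun i => i.2.map_imp _ _, fun _ => funext fun i => i.2.map_neg _,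
      funext fun i => i.2.map_top⟩,
    fun _ _ h => IsRDML.eq_of_forall_hom fun φ hφ => congrFun h ⟨φ, hφ⟩,
    ⟨fun _ _ => rfl, fun _ _ => rfl, fun _ _ => rfl, fun _ => rfl, rfl⟩, Function.surjective_id⟩

theorem InHSP.inEqClassOf {M : Type u} {A : Type v} [RDMSig M] [RDMSig A] (h : InHSP M A) :
    InEqClassOf M A := by
  obtain ⟨I, C, _, e, g, he, hinj, hg, hsurj⟩ := h
  intro s r hsr a
  obtain ⟨c, rfl⟩ : ∃ c : ℕ → C, g ∘ c = a :=
    ⟨fun n => (hsurj (a n)).choose, funext fun n => (hsurj (a n)).choose_spec⟩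
  rw [← hg.map_eval, ← hg.map_eval]
  congr 1
  refine hinj (funext fun i => ?_)
  have hi : IsRDMHom fun x => e x i :=
    ⟨fun x y => congrFun (he.map_inf x y) i, fun x y => congrFun (he.map_sup x y) i,
      fun x y => congrFun (he.map_imp x y) i, fun x => congrFun (he.map_neg x) i,
      congrFun he.map_top i⟩
  exact (hi.map_eval c s).trans ((hsr _).trans (hi.map_eval c r).symm)

/-! ## The cones and their product bilattices -/

/-- The map `ι` identifies `L` with the sublattice of elements below `⊤` and the operation `⇨` of
`L` with the relative complement. -/
structure IsConeMap {L : Type v} {A : Type u} [Min L] [Max L] [Top L] [HImp L] [RDMSig A]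
    (ι : L → A) : Prop where
  inj : Function.Injective ι
  map_inf : ∀ a b, ι (a ⊓ b) = ι a ⊓ ι b
  map_sup : ∀ a b, ι (a ⊔ b) = ι a ⊔ ι b
  map_top : ι ⊤ = ⊤
  map_imp : ∀ a b, ι (a ⇨ b) = (ι a ⇨ (ι a ⊓ ι b)) ⊓ ⊤
  inf_top : ∀ a, ι a ⊓ ⊤ = ι a

/-- The map of `L ⊙ L` that sends `⟨a, b⟩` to `f a ⊗ ¬ f b`. -/
def coneExt {L : Type v} {A : Type u} {B : Type w} [BilatSig B] (ι : L → A) (f : A → B)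
    (p : ProdBilat L) : B := f (ι p.fst) ⊗ₖ ￢f (ι p.snd)

theorem IsRDMHom.isReductHom {A : Type u} [RDMSig A] {φ : A → Four} (hφ : IsRDMHom φ) :
    IsReductHom φ :=
  ⟨hφ.map_inf, hφ.map_sup, hφ.map_imp, hφ.map_neg,
    fun b => hφ.map_top.trans (Four.kTop_eq b).symm⟩

theorem IsBilatHom.coneExt_apply {L : Type*} {A : Type*} {B : Type*} {C : Type*} [BilatSig B]
    [BilatSig C] {ψ : B → C} (hψ : IsBilatHom ψ) (ι : L → A) (f : A → B) (p : ProdBilat L) :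
    ψ (coneExt ι f p) = coneExt ι (ψ ∘ f) p := by
  simp only [coneExt, hψ.map_ktimes, hψ.map_neg, Function.comp]

/-- The map `a ↦ ⟨a ∧ ⊤, ¬a ∧ ⊤⟩` is recovered by the extension of a homomorphism. -/
theorem coneExt_emb {L : Type v} {A : Type u} [RDMSig A] {ι : L → A} {h : A → ProdBilat L} (h₁ : ∀ a, ι (h a).fst = a ⊓ ⊤)
    (h₂ : ∀ a, ι (h a).snd = ￢a ⊓ ⊤) {B : Type w} [BilatSig B] [IsImplicativeBilattice B]
    {f : A → B} (hf : IsReductHom f) (a : A) : coneExt ι f (h a) = f a := by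
  refine IsImplicativeBilattice.eq_of_forall_hom fun ψ hψ => ?_
  have hφ := hf.isRDMHom hψ
  rw [hψ.coneExt_apply, coneExt, h₁, h₂, hφ.map_inf, hφ.map_inf, hφ.map_neg, hφ.map_top,
    Function.comp]
  generalize ψ (f a) = x
  revert x; decide

theorem emb_injective {L : Type v} {A : Type u} [RDMSig A] [IsRDML A] {ι : L → A} {h : A → ProdBilat L} (h₁ : ∀ a, ι (h a).fst = a ⊓ ⊤)
    (h₂ : ∀ a, ι (h a).snd = ￢a ⊓ ⊤) : Function.Injective h :=
  fun a b hab => IsRDML.eq_of_forall_hom fun φ hφ => by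
    rw [← coneExt_emb h₁ h₂ hφ.isReductHom, hab, coneExt_emb h₁ h₂ hφ.isReductHom]

namespace IsConeMap

variable {L : Type v} {A : Type u} [Min L] [Max L] [Top L] [HImp L] [RDMSig A] {ι : L → A}

theorem hom_inf_top (hι : IsConeMap ι) {φ : A → Four} (hφ : IsRDMHom φ) (a : L) :
    φ (ι a) ⊓ ⊤ = φ (ι a) := by
  rw [← hφ.map_top, ← hφ.map_inf, hι.inf_top]

/-- All values `φ (ι a)` lie in the two-element chain `{f, ⊤}`. With that restriction each clause is
a finite check in `Four`. -/
theorem isBilatHom_coneExt_four (hι : IsConeMap ι) {φ : A → Four} (hφ : IsRDMHom φ) :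
    IsBilatHom (coneExt ι φ) := by
  constructor
  · rintro ⟨a, b⟩ ⟨c, d⟩
    change φ (ι (a ⊓ c)) ⊗ₖ ￢φ (ι (b ⊔ d)) =
      (φ (ι a) ⊗ₖ ￢φ (ι b)) ⊓ (φ (ι c) ⊗ₖ ￢φ (ι d))
    rw [hι.map_inf, hι.map_sup, hφ.map_inf, hφ.map_sup]
    have ha := hι.hom_inf_top hφ a
    have hb := hι.hom_inf_top hφ b
    have hc := hι.hom_inf_top hφ c
    have hd := hι.hom_inf_top hφ d
    generalize φ (ι a) = x, φ (ι b) = y, φ (ι c) = z, φ (ι d) = w at *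
    revert x y z w; decide
  · rintro ⟨a, b⟩ ⟨c, d⟩
    change φ (ι (a ⊔ c)) ⊗ₖ ￢φ (ι (b ⊓ d)) =
      (φ (ι a) ⊗ₖ ￢φ (ι b)) ⊔ (φ (ι c) ⊗ₖ ￢φ (ι d))
    rw [hι.map_inf, hι.map_sup, hφ.map_inf, hφ.map_sup]
    have ha := hι.hom_inf_top hφ a
    have hb := hι.hom_inf_top hφ b
    have hc := hι.hom_inf_top hφ c
    have hd := hι.hom_inf_top hφ d
    generalize φ (ι a) = x, φ (ι b) = y, φ (ι c) = z, φ (ι d) = w at *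
    revert x y z w; decide
  · rintro ⟨a, b⟩ ⟨c, d⟩
    change φ (ι (a ⊓ c)) ⊗ₖ ￢φ (ι (b ⊓ d)) =
      (φ (ι a) ⊗ₖ ￢φ (ι b)) ⊗ₖ (φ (ι c) ⊗ₖ ￢φ (ι d))
    rw [hι.map_inf, hι.map_inf, hφ.map_inf, hφ.map_inf]
    have ha := hι.hom_inf_top hφ a
    have hb := hι.hom_inf_top hφ b
    have hc := hι.hom_inf_top hφ c
    have hd := hι.hom_inf_top hφ d
    generalize φ (ι a) = x, φ (ι b) = y, φ (ι c) = z, φ (ι d) = w at *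
    revert x y z w; decide
  · rintro ⟨a, b⟩ ⟨c, d⟩
    change φ (ι (a ⊔ c)) ⊗ₖ ￢φ (ι (b ⊔ d)) =
      (φ (ι a) ⊗ₖ ￢φ (ι b)) ⊕ₖ (φ (ι c) ⊗ₖ ￢φ (ι d))
    rw [hι.map_sup, hι.map_sup, hφ.map_sup, hφ.map_sup]
    have ha := hι.hom_inf_top hφ a
    have hb := hι.hom_inf_top hφ b
    have hc := hι.hom_inf_top hφ c
    have hd := hι.hom_inf_top hφ d
    generalize φ (ι a) = x, φ (ι b) = y, φ (ι c) = z, φ (ι d) = w at *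
    revert x y z w; decide
  · rintro ⟨a, b⟩ ⟨c, d⟩
    change φ (ι (a ⇨ c)) ⊗ₖ ￢φ (ι (a ⊓ d)) =
      ((φ (ι a) ⊗ₖ ￢φ (ι b)) ⇨ (φ (ι c) ⊗ₖ ￢φ (ι d)))
    rw [hι.map_imp, hι.map_inf, hφ.map_inf, hφ.map_imp, hφ.map_inf, hφ.map_inf, hφ.map_top]
    have ha := hι.hom_inf_top hφ a
    have hb := hι.hom_inf_top hφ b
    have hc := hι.hom_inf_top hφ c
    have hd := hι.hom_inf_top hφ d
    generalize φ (ι a) = x, φ (ι b) = y, φ (ι c) = z, φ (ι d) = w at *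
    revert x y z w; decide
  · rintro ⟨a, b⟩
    change φ (ι b) ⊗ₖ ￢φ (ι a) = ￢(φ (ι a) ⊗ₖ ￢φ (ι b))
    have ha := hι.hom_inf_top hφ a
    have hb := hι.hom_inf_top hφ b
    generalize φ (ι a) = x, φ (ι b) = y at *
    revert x y; decide

/-- A homomorphism into an implicative bilattice extends to the product bilattice of a cone. -/
theorem isBilatHom_coneExt (hι : IsConeMap ι) {B : Type w} [BilatSig B]
    [IsImplicativeBilattice B] {f : A → B} (hf : IsReductHom f) : IsBilatHom (coneExt ι f) := by
  have e : ∀ {ψ : B → Four}, IsBilatHom ψ → IsBilatHom (coneExt ι (ψ ∘ f)) :=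
    fun hψ => hι.isBilatHom_coneExt_four (hf.isRDMHom hψ)
  constructor
  all_goals
    intros
    refine IsImplicativeBilattice.eq_of_forall_hom fun ψ hψ => ?_
  · rw [hψ.map_inf]; simp only [hψ.coneExt_apply, (e hψ).map_inf]
  · rw [hψ.map_sup]; simp only [hψ.coneExt_apply, (e hψ).map_sup]
  · rw [hψ.map_ktimes]; simp only [hψ.coneExt_apply, (e hψ).map_ktimes]
  · rw [hψ.map_kplus]; simp only [hψ.coneExt_apply, (e hψ).map_kplus]
  · rw [hψ.map_imp]; simp only [hψ.coneExt_apply, (e hψ).map_imp]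
  · rw [hψ.map_neg]; simp only [hψ.coneExt_apply, (e hψ).map_neg]

/-- Meeting with `⊤` recovers the first coordinate, and negating beforehand recovers the second;
hence the maps `coneExt ι φ` separate the points of the product. -/
theorem four_coneExt_fst (hι : IsConeMap ι) {φ : A → Four} (hφ : IsRDMHom φ) (p : ProdBilat L) :
    coneExt ι φ p ⊓ ⊤ = φ (ι p.fst) := by
  have ha := hι.hom_inf_top hφ p.fst
  have hb := hι.hom_inf_top hφ p.snd
  rw [coneExt]
  generalize φ (ι p.fst) = x, φ (ι p.snd) = y at *
  revert x y; decide

theorem four_coneExt_snd (hι : IsConeMap ι) {φ : A → Four} (hφ : IsRDMHom φ) (p : ProdBilat L) :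
    ￢coneExt ι φ p ⊓ ⊤ = φ (ι p.snd) := by
  have ha := hι.hom_inf_top hφ p.fst
  have hb := hι.hom_inf_top hφ p.snd
  rw [coneExt]
  generalize φ (ι p.fst) = x, φ (ι p.snd) = y at *
  revert x y; decide

theorem coneExt_injective (hι : IsConeMap ι) {B : Type w} [BilatSig B]
    [IsImplicativeBilattice B] {f : A → B} (hf : IsReductHom f) (hinj : Function.Injective f) :
    Function.Injective (coneExt ι f) := by
  intro p q h
  have e : ∀ ψ : B → Four, IsBilatHom ψ → coneExt ι (ψ ∘ f) p = coneExt ι (ψ ∘ f) q :=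
    fun ψ hψ => by rw [← hψ.coneExt_apply, ← hψ.coneExt_apply, h]
  ext
  · refine hι.inj (hinj (IsImplicativeBilattice.eq_of_forall_hom fun ψ hψ => ?_))
    have h₁ := hι.four_coneExt_fst (hf.isRDMHom hψ) p
    rw [e ψ hψ, hι.four_coneExt_fst (hf.isRDMHom hψ)] at h₁
    exact h₁.symm
  · refine hι.inj (hinj (IsImplicativeBilattice.eq_of_forall_hom fun ψ hψ => ?_))
    have h₁ := hι.four_coneExt_snd (hf.isRDMHom hψ) p
    rw [e ψ hψ, hι.four_coneExt_snd (hf.isRDMHom hψ)] at h₁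
    exact h₁.symm

variable [IsRDML A]

theorem isImplicativeBilattice (hι : IsConeMap ι) : IsImplicativeBilattice (ProdBilat L) := by
  refine .of_forall_hom fun p q h => ?_
  ext
  · refine hι.inj (IsRDML.eq_of_forall_hom fun φ hφ => ?_)
    rw [← hι.four_coneExt_fst hφ, ← hι.four_coneExt_fst hφ, h _ (hι.isBilatHom_coneExt_four hφ)]
  · refine hι.inj (IsRDML.eq_of_forall_hom fun φ hφ => ?_)
    rw [← hι.four_coneExt_snd hφ, ← hι.four_coneExt_snd hφ, h _ (hι.isBilatHom_coneExt_four hφ)]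

theorem eq_of_forall_coneExt (hι : IsConeMap ι) {p q : ProdBilat L}
    (h : ∀ φ : A → Four, IsRDMHom φ → coneExt ι φ p = coneExt ι φ q) : p = q := by
  ext
  · refine hι.inj (IsRDML.eq_of_forall_hom fun φ hφ => ?_)
    rw [← hι.four_coneExt_fst hφ, ← hι.four_coneExt_fst hφ, h φ hφ]
  · refine hι.inj (IsRDML.eq_of_forall_hom fun φ hφ => ?_)
    rw [← hι.four_coneExt_snd hφ, ← hι.four_coneExt_snd hφ, h φ hφ]

theorem hImpIsRelCompl (hι : IsConeMap ι) : HImpIsRelCompl L := by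
  intro a b c
  constructor
  · rintro ⟨h₁, h₂⟩
    refine hι.inj (IsRDML.eq_of_forall_hom fun φ hφ => ?_)
    replace h₁ := congrArg (fun x => φ (ι x)) h₁
    replace h₂ := congrArg (fun x => φ (ι x)) h₂
    simp only [hι.map_inf, hι.map_sup, hι.map_top, hφ.map_inf, hφ.map_sup, hφ.map_top] at h₁ h₂
    rw [hι.map_imp, hφ.map_inf, hφ.map_imp, hφ.map_inf, hφ.map_top]
    have ha := hι.hom_inf_top hφ a
    have hb := hι.hom_inf_top hφ b
    have hc := hι.hom_inf_top hφ c
    generalize φ (ι a) = x, φ (ι b) = y, φ (ι c) = z at *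
    revert x y z; decide
  · rintro rfl
    constructor
    all_goals
      refine hι.inj (IsRDML.eq_of_forall_hom fun φ hφ => ?_)
      simp only [hι.map_inf, hι.map_sup, hι.map_top, hι.map_imp, hφ.map_inf, hφ.map_sup,
        hφ.map_top, hφ.map_imp]
      have ha := hι.hom_inf_top hφ a
      have hb := hι.hom_inf_top hφ b
      generalize φ (ι a) = x, φ (ι b) = y at *
      revert x y; decide

/-- Composing `h` with `coneExt ι φ` gives back `φ`, and these maps separate points. -/
theorem isReductHom_emb (hι : IsConeMap ι) {h : A → ProdBilat L}
    (h₁ : ∀ a, ι (h a).fst = a ⊓ ⊤) (h₂ : ∀ a, ι (h a).snd = ￢a ⊓ ⊤) : IsReductHom h := by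
  have e : ∀ {φ : A → Four}, IsRDMHom φ → ∀ a, coneExt ι φ (h a) = φ a :=
    fun hφ => coneExt_emb h₁ h₂ hφ.isReductHom
  constructor
  all_goals
    intros
    refine hι.eq_of_forall_coneExt fun φ hφ => ?_
    have hc := hι.isBilatHom_coneExt_four hφ
  · rw [hc.map_inf, e hφ, e hφ, e hφ, hφ.map_inf]
  · rw [hc.map_sup, e hφ, e hφ, e hφ, hφ.map_sup]
  · rw [hc.map_imp, e hφ, e hφ, e hφ, hφ.map_imp]
  · rw [hc.map_neg, e hφ, e hφ, hφ.map_neg]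
  · rw [e hφ, hφ.map_top, kTop, hc.map_kplus, hc.map_neg, hc.map_imp]
    exact (Four.kTop_eq _).symm

/-- A homomorphism out of the product bilattice is determined by its values on `A`. -/
theorem eq_coneExt (hι : IsConeMap ι) {h : A → ProdBilat L} (h₁ : ∀ a, ι (h a).fst = a ⊓ ⊤)
    (h₂ : ∀ a, ι (h a).snd = ￢a ⊓ ⊤) {B : Type w} [BilatSig B] {g : ProdBilat L → B}
    (hg : IsBilatHom g) : g = coneExt ι (g ∘ h) := by
  funext p
  -- As `g` is a homomorphism, it suffices that `p = h (ι p.fst) ⊗ₖ ￢h (ι p.snd)`, so the image of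
  -- `h` generates the product.
  rw [← hg.coneExt_apply]
  congr 1
  refine hι.eq_of_forall_coneExt fun φ hφ => ?_
  have hc := hι.isBilatHom_coneExt_four hφ
  rw [hc.coneExt_apply]
  have e : coneExt ι φ ∘ h = φ := funext (coneExt_emb h₁ h₂ hφ.isReductHom)
  rw [e]

end IsConeMap

/-! ### The two cones and their relative complements -/

section

variable (A : Type u) [RDMSig A] [IsRDML A]

theorem isConeMap_negCone : IsConeMap (fun a : NegCone A => a.1) where
  inj := Subtype.val_injective
  map_inf _ _ := rfl
  map_sup _ _ := rfl
  map_top := rfl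
  map_imp _ _ := rfl
  inf_top a := a.2

theorem IsRDML.neg_injective : Function.Injective fun x : A => ￢x :=
  Function.LeftInverse.injective IsRDML.neg_neg

variable {A} in
theorem IsRDML.neg_inf_top {x : A} (h : ⊤ ⊓ x = ⊤) : ￢x ⊓ ⊤ = ￢x := by
  replace h := congrArg (￢·) h
  simp only [neg_inf, ← rd0] at h
  conv_lhs => rw [← h, (lattice (A := A)).join_comm]
  exact (lattice (A := A)).meet_join _ _

variable {A} in
theorem IsRDML.top_inf_neg {x : A} (h : x ⊓ ⊤ = x) : ⊤ ⊓ ￢x = ⊤ := by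
  rw [← h, neg_inf, ← rd0, (lattice (A := A)).join_comm]
  exact (lattice (A := A)).meet_join _ _

/-- Negation carries the dual of `A⁺` to `A⁻` with all its operations, so no argument has to be
repeated for `A⁺`. -/
theorem isConeMap_posCone :
    IsConeMap (fun a : (PosCone A)ᵒᵈ => ￢(OrderDual.ofDual a).1) where
  inj := fun _ _ h => Subtype.val_injective (IsRDML.neg_injective A h)
  map_inf a b := IsRDML.neg_sup _ _
  map_sup a b := IsRDML.neg_inf _ _
  map_top := IsRDML.rd0.symm
  map_imp a b := by
    refine (IsRDML.neg_sup _ _).trans ?_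
    rw [IsRDML.neg_neg, IsRDML.neg_sup, ← IsRDML.rd0]
  inf_top a := IsRDML.neg_inf_top (OrderDual.ofDual a).2

/-- The negation as a dual isomorphism of the two cones. -/
def negConeEquiv : NegCone A ≃ PosCone A where
  toFun a := ⟨￢a.1, IsRDML.top_inf_neg a.2⟩
  invFun a := ⟨￢a.1, IsRDML.neg_inf_top a.2⟩
  left_inv _ := Subtype.ext (IsRDML.neg_neg _)
  right_inv _ := Subtype.ext (IsRDML.neg_neg _)

theorem isRelativelyComplemented_negCone : IsRelativelyComplemented (NegCone A) := by
  intro a b c hab hbc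
  -- The complement of `b` in `[a, ⊤]`, cut down to `c`.
  refine ⟨(b ⇨ a) ⊓ c, ?_, ?_⟩
  all_goals
    have hι := isConeMap_negCone A
    refine hι.inj (IsRDML.eq_of_forall_hom fun φ hφ => ?_)
    replace hab := congrArg (fun x : NegCone A => φ x.1) hab
    replace hbc := congrArg (fun x : NegCone A => φ x.1) hbc
    have ha := hι.hom_inf_top hφ a
    have hb := hι.hom_inf_top hφ b
    have hc := hι.hom_inf_top hφ c
    simp only [hι.map_inf, hι.map_sup, hι.map_imp, hφ.map_inf, hφ.map_sup, hφ.map_imp,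
      hφ.map_top] at hab hbc ⊢
    generalize φ a.1 = x, φ b.1 = y, φ c.1 = z at *
    revert x y z; decide

theorem isRelativelyComplemented_posCone : IsRelativelyComplemented (PosCone A) := by
  have hinf : ∀ a b, negConeEquiv A (a ⊓ b) = negConeEquiv A a ⊔ negConeEquiv A b :=
    fun a b => Subtype.ext (IsRDML.neg_inf _ _)
  have hsup : ∀ a b, negConeEquiv A (a ⊔ b) = negConeEquiv A a ⊓ negConeEquiv A b :=
    fun a b => Subtype.ext (IsRDML.neg_sup _ _)
  have e : ∀ a b : NegCone A, a ⊔ b = a → b ⊓ a = b := fun a b h => by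
    conv_lhs => rw [← h]
    refine Subtype.ext ?_
    change b.1 ⊓ (a.1 ⊔ b.1) = b.1
    rw [(IsRDML.lattice (A := A)).join_comm]
    exact (IsRDML.lattice (A := A)).meet_join _ _
  intro a b c hab hbc
  obtain ⟨a, rfl⟩ := (negConeEquiv A).surjective a
  obtain ⟨b, rfl⟩ := (negConeEquiv A).surjective b
  obtain ⟨c, rfl⟩ := (negConeEquiv A).surjective c
  rw [← hsup, (negConeEquiv A).injective.eq_iff] at hab hbc
  -- The dual isomorphism reverses the interval, so the endpoints are exchanged.
  obtain ⟨d, h₁, h₂⟩ := isRelativelyComplemented_negCone A c b a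
    (e b c hbc) (e a b hab)
  exact ⟨negConeEquiv A d, by rw [← hsup, h₂], by rw [← hinf, h₁]⟩

end

/-! ## Algebras with four elements -/

namespace IsRDML

variable {A : Type u} [RDMSig A] [IsRDML A]

theorem eq_of_inf_top {a b : A} (h₁ : a ⊓ ⊤ = b ⊓ ⊤) (h₂ : ￢a ⊓ ⊤ = ￢b ⊓ ⊤) : a = b :=
  emb_injective (ι := fun a : NegCone A => a.1) (h := negEmb) (fun _ => rfl) (fun _ => rfl)
    (by simp only [negEmb, h₁, h₂])

theorem exists_lt_top [Nontrivial A] : ∃ z : A, z ⊓ ⊤ = z ∧ z ≠ ⊤ := by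
  by_contra! hn
  have h : ∀ x : A, x ⊓ ⊤ = ⊤ := fun x => hn _ (inf_top_mem x)
  obtain ⟨a, b, hab⟩ := exists_pair_ne A
  exact hab (eq_of_inf_top ((h a).trans (h b).symm) ((h _).trans (h _).symm))

/-- A second element strictly below `⊤` would give five distinct elements, since negation moves both
strictly above `⊤`. -/
theorem eq_or_eq_top_of_card (hcard : Nat.card A = 4) {z x : A} (hz : z ⊓ ⊤ = z) (hz' : z ≠ ⊤)
    (hx : x ⊓ ⊤ = x) : x = z ∨ x = ⊤ := by
  classical
  by_contra! hn
  have : Finite A := Nat.finite_of_card_ne_zero (by omega)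
  have := Fintype.ofFinite A
  have ne_top : ∀ {y : A}, y ≠ ⊤ → ￢y ≠ ⊤ := fun {y} hy h =>
    hy (neg_injective A (h.trans rd0))
  have ne_neg : ∀ {y w : A}, y ⊓ ⊤ = y → w ⊓ ⊤ = w → y ≠ ⊤ → y ≠ ￢w := by
    rintro _ w hy hw hne rfl
    rw [(lattice (A := A)).meet_comm, top_inf_neg hw] at hy
    exact hne hy.symm
  have nodup : [z, x, ⊤, ￢z, ￢x].Nodup := by
    have h := (neg_injective A).ne hn.1.symm
    simp [hz', hn.1.symm, hn.2, ne_neg hz hz hz', ne_neg hz hx hz', ne_neg hx hz hn.2,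
      ne_neg hx hx hn.2, (ne_top hz').symm, (ne_top hn.2).symm, h]
  have h := nodup.length_le_card
  rw [← Nat.card_eq_fintype_card, hcard] at h
  simp at h

/-- Here `A⁻` is `{z, ⊤}`, so a homomorphism separating `z` from `⊤` is injective on `A⁻`. Elements
are determined by their meet and their negation's meet with `⊤`, so it is injective on `A`; counting
finishes. -/
theorem exists_bijective_hom_of_card (hcard : Nat.card A = 4) :
    ∃ g : A → Four, IsRDMHom g ∧ Function.Bijective g := by
  have : Finite A := Nat.finite_of_card_ne_zero (by omega)
  have : Nontrivial A := Finite.one_lt_card_iff_nontrivial.1 (by omega)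
  obtain ⟨z, hz, hz'⟩ := exists_lt_top (A := A)
  obtain ⟨φ, hφ, hne⟩ : ∃ φ : A → Four, IsRDMHom φ ∧ φ z ≠ φ ⊤ := by
    by_contra! h
    exact hz' (eq_of_forall_hom h)
  have inj : ∀ x y : A, x ⊓ ⊤ = x → y ⊓ ⊤ = y → φ x = φ y → x = y := by
    intro x y hx hy h
    rcases eq_or_eq_top_of_card hcard hz hz' hx with rfl | rfl <;>
      rcases eq_or_eq_top_of_card hcard hz hz' hy with rfl | rfl
    · rfl
    · exact absurd h hne
    · exact absurd h.symm hne
    · rfl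
  refine ⟨φ, hφ, (Nat.bijective_iff_injective_and_card φ).2 ⟨fun a b h => ?_, ?_⟩⟩
  · refine eq_of_inf_top (inj _ _ (inf_top_mem a) (inf_top_mem b) ?_)
      (inj _ _ (inf_top_mem _) (inf_top_mem _) ?_)
    · rw [hφ.map_inf, hφ.map_inf, h]
    · rw [hφ.map_inf, hφ.map_inf, hφ.map_neg, hφ.map_neg, h]
  · rw [hcard, Nat.card_eq_fintype_card]
    rfl

end IsRDML

theorem theoremt :
    -- the embedding into `A⁻ ⊙ A⁻` and its universal property
    (∀ (A : Type u) [RDMSig A] [IsRDML A],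
      (∃ g : NegCone A ≃ PosCone A,
        (∀ a b, g (a ⊓ b) = g a ⊔ g b) ∧ (∀ a b, g (a ⊔ b) = g a ⊓ g b)) ∧
      (IsRelativelyComplemented (NegCone A) ∧ IsRelativelyComplemented (PosCone A)) ∧
      (HImpIsRelCompl (NegCone A) ∧
        IsImplicativeBilattice (ProdBilat (NegCone A)) ∧
        IsReductHom (negEmb : A → ProdBilat (NegCone A)) ∧
        Function.Injective (negEmb : A → ProdBilat (NegCone A))) ∧
      (HImpIsRelCompl (PosCone A)ᵒᵈ ∧
        IsImplicativeBilattice (ProdBilat (PosCone A)ᵒᵈ) ∧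
        IsReductHom (posEmb : A → ProdBilat (PosCone A)ᵒᵈ) ∧
        Function.Injective (posEmb : A → ProdBilat (PosCone A)ᵒᵈ)) ∧
      (∀ (B₁ : Type v) [BilatSig B₁] [IsImplicativeBilattice B₁] (f : A → B₁), IsReductHom f →
        (∃! f' : ProdBilat (NegCone A) → B₁, IsBilatHom f' ∧ f' ∘ negEmb = f) ∧
        (Function.Injective f → ∀ f' : ProdBilat (NegCone A) → B₁,
          IsBilatHom f' → f' ∘ negEmb = f → Function.Injective f'))) ∧
    -- residuated De Morgan lattices are exactly the subreducts of implicative bilattices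
    (∀ (A : Type u) [RDMSig A],
      IsRDML A ↔
        ∃ (B : Type (max u v)) (_ : BilatSig B) (_ : IsImplicativeBilattice B) (f : A → B),
          IsReductHom f ∧ Function.Injective f) ∧
    -- `Four` is, up to isomorphism, the only four-element residuated De Morgan lattice
    (IsRDML Four ∧ Nat.card Four = 4 ∧
      ∀ (A : Type u) [RDMSig A] [IsRDML A], Nat.card A = 4 →
        ∃ g : A → Four, IsRDMHom g ∧ Function.Bijective g) ∧
    -- the variety of residuated De Morgan lattices is generated by `Four`
    (∀ (A : Type u) [RDMSig A],
      (IsRDML A ↔ InEqClassOf Four A) ∧ (IsRDML A ↔ InHSP Four A)) := by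
  refine ⟨fun A _ _ => ⟨⟨negConeEquiv A, fun a b => Subtype.ext (IsRDML.neg_inf _ _),
    fun a b => Subtype.ext (IsRDML.neg_sup _ _)⟩,
    ⟨isRelativelyComplemented_negCone A, isRelativelyComplemented_posCone A⟩, ?_, ?_, ?_⟩,
    fun A _ => ⟨fun _ => IsRDML.exists_reductHom A, ?_⟩,
    ⟨inferInstance, Nat.card_eq_fintype_card, fun A _ _ => IsRDML.exists_bijective_hom_of_card⟩,
    fun A _ => ⟨⟨fun _ => IsRDML.inEqClassOf A, InEqClassOf.isRDML⟩,
      ⟨fun _ => IsRDML.inHSP A, fun h => h.inEqClassOf.isRDML⟩⟩⟩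
  · have hι := isConeMap_negCone A
    exact ⟨hι.hImpIsRelCompl, hι.isImplicativeBilattice,
      hι.isReductHom_emb (fun _ => rfl) fun _ => rfl,
      emb_injective (ι := fun a : NegCone A => a.1) (fun _ => rfl) fun _ => rfl⟩
  · have hι := isConeMap_posCone A
    have h₁ : ∀ a : A, ￢(￢a ⊔ ⊤) = a ⊓ ⊤ := fun a => by
      rw [IsRDML.neg_sup, IsRDML.neg_neg, ← IsRDML.rd0]
    have h₂ : ∀ a : A, ￢(a ⊔ ⊤) = ￢a ⊓ ⊤ := fun a => by
      rw [IsRDML.neg_sup, ← IsRDML.rd0]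
    exact ⟨hι.hImpIsRelCompl, hι.isImplicativeBilattice, hι.isReductHom_emb h₁ h₂,
      emb_injective (ι := fun a : (PosCone A)ᵒᵈ => ￢(OrderDual.ofDual a).1) h₁ h₂⟩
  · intro B₁ _ _ f hf
    have hι := isConeMap_negCone A
    have h₁ : ∀ a : A, (negEmb a).fst.1 = a ⊓ ⊤ := fun _ => rfl
    have h₂ : ∀ a : A, (negEmb a).snd.1 = ￢a ⊓ ⊤ := fun _ => rfl
    have uniq : ∀ f' : ProdBilat (NegCone A) → B₁, IsBilatHom f' → f' ∘ negEmb = f →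
        f' = coneExt (fun a : NegCone A => a.1) f := fun f' hf' he => by
      rw [← he]
      exact hι.eq_coneExt h₁ h₂ hf'
    refine ⟨⟨coneExt (fun a : NegCone A => a.1) f,
      ⟨hι.isBilatHom_coneExt hf, funext fun a => coneExt_emb h₁ h₂ hf a⟩,
      fun f' h => uniq f' h.1 h.2⟩, fun hinj f' hf' he => ?_⟩
    rw [uniq f' hf' he]
    exact hι.coneExt_injective hf hinj
  · rintro ⟨B, _, _, f, hf, hinj⟩
    exact hf.isRDML hinj
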